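/- Let $\Theta$ be a Borel subset of a Polish space, $\mu$ a $\sigma$-finite measure on $\mathcal B(\Theta)$, and $\mathbb G$ a stochastic kernel on $\Theta$ such that, for every $\ell\in\Theta$, $\mathbb G(\ell,\cdot)$ has a density $g(\ell,\cdot)$ with respect to $\mu$. Let $\{\vartheta(k)\}_{k\ge 0}$ denote the time-homogeneous Markov chain with kernel $\mathbb G$. Notation. $\mathcal H_\infty^{n\times m}$ is the set of measurable, $\mu$-essentially bounded functions $\Theta\to\mathbb R^{n\times m}$, and $\mathcal{SH}_\infty^n$ is the set of symmetric-valued elements of $\mathcal H_\infty^{n\times n}$. For a symmetric-matrix-valued function $S$ we write $S\gg0$ if there is $\xi>0$ with $S(\ell)\ge\xi I$ for $\mu$-a.e. $\ell$. A system $x(k+1)=A(\vartheta(k))x(k)$, $x(0)=x_0$, is called exponentially mean-square stable (EMSS) if there are $\beta\ge1$ and $\alpha\in(0,1)$ such that $\mathbf E\|x(k)\|^2\le\beta\alpha^k\|x_0\|^2$ for all $k\ge 0$, all deterministic $x_0\in\mathbb R^n$ and all initial distributions of $\vartheta(0)$ that are absolutely continuous with respect to $\mu$. Let $A\in\mathcal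 H_\infty^{n\times n}$, $G\in\mathcal H_\infty^{n\times m}$, let $Q\in\mathcal{SH}_\infty^n$ with $Q(\ell)\le0$ $\mu$-a.e., and let $R\in\mathcal{SH}_\infty^m$ with $R\gg0$. For $P\in\mathcal{SH}_\infty^n$ put $$\mathcal E(P)(\ell)=\int_\Theta g(\ell,t)P(t)\,\mu(dt),\qquad \mathcal T_S(P)(\ell)=S(\ell)^T\mathcal E(P)(\ell)S(\ell)\quad (S=A \text{ or } S=G),$$ $$\mathcal G(P)(\ell)=G(\ell)^T\mathcal E(P)(\ell)A(\ell),\qquad \mathcal R(P)(\ell)=R(\ell)+\mathcal T_G(P)(\ell),\qquad \mathcal M(P)(\ell)=-\mathcal R(P)(\ell)^{-1}\mathcal G(P)(\ell).$$ Consider the coupled algebraic Riccati equations $$P(\ell)=\mathcal T_A(P)(\ell)+Q(\ell)-\mathcal G(P)(\ell)^T\mathcal R(P)(\ell)^{-1}\mathcal G(P)(\ell)\quad\mu\text{-a.e.}\qquad(*)$$ A solution of $(*)$ is a $P\in\mathcal{SH}_\infty^n$ for which $\mathcal R(P)(\ell)$ is invertible for $\mu$-a.e. $\ell$ and $(*)$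 holds. A solution $P$ is called stabilizing if $\mathcal M(P)\in\mathcal H_\infty^{m\times n}$ and the system $x(k+1)=[A(\vartheta(k))+G(\vartheta(k))\mathcal M(P)(\vartheta(k))]x(k)$ is EMSS. Suppose that there is $P\in\mathcal{SH}_\infty^n$ such that $-P\gg0$ and $$\begin{bmatrix}-P+\mathcal T_A(P)+Q & \mathcal G(P)^T\\ \mathcal G(P)&\mathcal R(P)\end{bmatrix}\gg0 .$$ Then $(*)$ has a stabilizing solution; it is unique up to $\mu$-a.e. equality, and it satisfies the sign condition $\mathcal R(P)\gg0$. -/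

import Mathlib

open MeasureTheory ProbabilityTheory Filter
open scoped ENNReal NNReal Matrix Matrix.Norms.L2Operator

noncomputable section

namespace MJLS

variable {Θ : Type*} [MeasurableSpace Θ]

/-! ### Spaces of matrix-valued functions -/

/-- `𝓗_∞^{n×m}`: (entrywise) measurable matrix-valued functions on `Θ` whose operator norm is
`μ`-essentially bounded.  The norm on matrices is the operator norm for Euclidean norms. -/
structure MemHInf {n m : ℕ} (μ : Measure Θ) (Q : Θ → Matrix (Fin n) (Fin m) ℝ) : Prop where
  measurable : ∀ i j, Measurable fun ℓ => Q ℓ i j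
  bounded : ∃ c : ℝ, ∀ᵐ ℓ ∂μ, ‖Q ℓ‖ ≤ c

/-- `𝓢𝓗_∞^n`: the members of `𝓗_∞^{n×n}` with symmetric values. -/
structure MemSHInf {n : ℕ} (μ : Measure Θ) (Q : Θ → Matrix (Fin n) (Fin n) ℝ) : Prop
    extends MemHInf μ Q where
  symm : ∀ ℓ, (Q ℓ).IsSymm

/-- `Q(ℓ) ≫ 0` `μ`-a.e.: there is `ξ > 0` with `Q(ℓ) ≥ ξ I` for `μ`-almost every `ℓ`. -/
def UnifPos {ι : Type*} [Fintype ι] [DecidableEq ι] (μ : Measure Θ) (Q : Θ → Matrix ι ι ℝ) :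
    Prop :=
  ∃ ξ : ℝ, 0 < ξ ∧ ∀ᵐ ℓ ∂μ, (Q ℓ - ξ • (1 : Matrix ι ι ℝ)).PosSemidef

/-- `𝓗_∞^{n-}`: the members of `𝓢𝓗_∞^n` that are negative semidefinite `μ`-a.e. -/
def MemHInfNonpos {n : ℕ} (μ : Measure Θ) (Q : Θ → Matrix (Fin n) (Fin n) ℝ) : Prop :=
  MemSHInf μ Q ∧ ∀ᵐ ℓ ∂μ, (-Q ℓ).PosSemidef

/-- `𝓗_∞^{n+*}`: the members of `𝓢𝓗_∞^n` that are uniformly positive definite `μ`-a.e. -/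
def MemHInfUnifPos {n : ℕ} (μ : Measure Θ) (Q : Θ → Matrix (Fin n) (Fin n) ℝ) : Prop :=
  MemSHInf μ Q ∧ UnifPos μ Q

/-! ### The Markov chain and exponential mean-square stability -/

/-- The kernel `𝔾` has density `g(ℓ, ·)` with respect to `μ`, for every `ℓ`. -/
def HasDensity (μ : Measure Θ) (𝔾 : Kernel Θ Θ) (g : Θ → Θ → ℝ≥0) : Prop :=
  ∀ ℓ, Measurable (g ℓ) ∧ 𝔾 ℓ = μ.withDensity fun t => (g ℓ t : ℝ≥0∞)

/-- The transition kernel, at time `k`, of the Markov chain with stochastic kernel `𝔾`: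
the conditional law of `ϑ(k+1)` given the history `ϑ(0), …, ϑ(k)` is `𝔾(ϑ(k), ·)`. -/
def stepKernel (𝔾 : Kernel Θ Θ) (k : ℕ) : Kernel (Finset.Iic k → Θ) Θ :=
  𝔾.comap (fun h => h ⟨k, Finset.mem_Iic.2 le_rfl⟩) (measurable_pi_apply _)

instance (𝔾 : Kernel Θ Θ) [IsMarkovKernel 𝔾] (k : ℕ) : IsMarkovKernel (stepKernel 𝔾 k) := by
  unfold stepKernel
  infer_instance

/-- The law, on the space of trajectories `ℕ → Θ`, of the time-homogeneous Markov chain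
`{ϑ(k)}` with initial distribution `μ₀` and stochastic kernel `𝔾`.  The chain itself is the
coordinate process `ϑ(k)(ω) = ω k`. -/
def chainLaw (μ₀ : Measure Θ) (𝔾 : Kernel Θ Θ) [IsMarkovKernel 𝔾] : Measure (ℕ → Θ) :=
  Kernel.trajMeasure (X := fun _ => Θ) μ₀ (stepKernel 𝔾)

/-- The state of `x(k+1) = A(ϑ(k)) x(k)`, `x(0) = x₀`, along the trajectory `ϑ`. -/
def state {n : ℕ} (A : Θ → Matrix (Fin n) (Fin n) ℝ) (x₀ : EuclideanSpace ℝ (Fin n))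
    (ϑ : ℕ → Θ) : ℕ → EuclideanSpace ℝ (Fin n)
  | 0 => x₀
  | k + 1 => Matrix.toEuclideanCLM (𝕜 := ℝ) (A (ϑ k)) (state A x₀ ϑ k)

/-- `(A|𝔾)` is exponentially mean-square stable: there are `β ≥ 1` and `α ∈ (0,1)` with
`𝐄‖x(k)‖² ≤ β αᵏ ‖x₀‖²` for all `k`, all deterministic `x₀`, and all initial distributions
`μ₀ ≪ μ` of the Markov chain. -/
def EMSS {n : ℕ} (μ : Measure Θ) (𝔾 : Kernel Θ Θ) [IsMarkovKernel 𝔾]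
    (A : Θ → Matrix (Fin n) (Fin n) ℝ) : Prop :=
  ∃ β α : ℝ, 1 ≤ β ∧ 0 < α ∧ α < 1 ∧
    ∀ μ₀ : Measure Θ, IsProbabilityMeasure μ₀ → μ₀ ≪ μ →
      ∀ (x₀ : EuclideanSpace ℝ (Fin n)) (k : ℕ),
        ∫⁻ ϑ, ‖state A x₀ ϑ k‖ₑ ^ 2 ∂(chainLaw μ₀ 𝔾) ≤ ENNReal.ofReal (β * α ^ k * ‖x₀‖ ^ 2)

/-- `u(k) = K(ϑ(k)) x(k)` exponentially stabilizes `(A, G|𝔾)`: `K ∈ 𝓗_∞^{m×n}` and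
`(A + GK|𝔾)` is exponentially mean-square stable. -/
def Stabilizes {n m : ℕ} (μ : Measure Θ) (𝔾 : Kernel Θ Θ) [IsMarkovKernel 𝔾]
    (A : Θ → Matrix (Fin n) (Fin n) ℝ) (G : Θ → Matrix (Fin n) (Fin m) ℝ)
    (K : Θ → Matrix (Fin m) (Fin n) ℝ) : Prop :=
  MemHInf μ K ∧ EMSS μ 𝔾 fun ℓ => A ℓ + G ℓ * K ℓ

/-! ### The operators in the coupled algebraic Riccati equations -/

/-- `𝓔(U)(ℓ) = ∫ g(ℓ,t) U(t) μ(dt)`, entry by entry. -/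
def opE {n : ℕ} (μ : Measure Θ) (g : Θ → Θ → ℝ≥0) (U : Θ → Matrix (Fin n) (Fin n) ℝ) :
    Θ → Matrix (Fin n) (Fin n) ℝ :=
  fun ℓ => Matrix.of fun i j => ∫ t, (g ℓ t : ℝ) * U t i j ∂μ

/-- `𝓣_S(U)(ℓ) = S(ℓ)ᵀ 𝓔(U)(ℓ) S(ℓ)`. -/
def opT {n m : ℕ} (μ : Measure Θ) (g : Θ → Θ → ℝ≥0) (S : Θ → Matrix (Fin n) (Fin m) ℝ)
    (U : Θ → Matrix (Fin n) (Fin n) ℝ) : Θ → Matrix (Fin m) (Fin m) ℝ :=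
  fun ℓ => (S ℓ)ᵀ * opE μ g U ℓ * S ℓ

/-- `𝓖(P)(ℓ) = G(ℓ)ᵀ 𝓔(P)(ℓ) A(ℓ)`. -/
def opG {n m : ℕ} (μ : Measure Θ) (g : Θ → Θ → ℝ≥0) (A : Θ → Matrix (Fin n) (Fin n) ℝ)
    (G : Θ → Matrix (Fin n) (Fin m) ℝ) (P : Θ → Matrix (Fin n) (Fin n) ℝ) :
    Θ → Matrix (Fin m) (Fin n) ℝ :=
  fun ℓ => (G ℓ)ᵀ * opE μ g P ℓ * A ℓ

/-- `𝓡(P)(ℓ) = R(ℓ) + 𝓣_G(P)(ℓ)`. -/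
def opR {n m : ℕ} (μ : Measure Θ) (g : Θ → Θ → ℝ≥0) (G : Θ → Matrix (Fin n) (Fin m) ℝ)
    (R : Θ → Matrix (Fin m) (Fin m) ℝ) (P : Θ → Matrix (Fin n) (Fin n) ℝ) :
    Θ → Matrix (Fin m) (Fin m) ℝ :=
  fun ℓ => R ℓ + opT μ g G P ℓ

/-- `𝓜(P)(ℓ) = -𝓡(P)(ℓ)⁻¹ 𝓖(P)(ℓ)`. -/
def opM {n m : ℕ} (μ : Measure Θ) (g : Θ → Θ → ℝ≥0) (A : Θ → Matrix (Fin n) (Fin n) ℝ)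
    (G : Θ → Matrix (Fin n) (Fin m) ℝ) (R : Θ → Matrix (Fin m) (Fin m) ℝ)
    (P : Θ → Matrix (Fin n) (Fin n) ℝ) : Θ → Matrix (Fin m) (Fin n) ℝ :=
  fun ℓ => -((opR μ g G R P ℓ)⁻¹ * opG μ g A G P ℓ)

/-- The block matrix with rows `(-P + 𝓣_A(P) + Q, 𝓖(P)ᵀ)` and `(𝓖(P), 𝓡(P))`. -/
def blockLMI {n m : ℕ} (μ : Measure Θ) (g : Θ → Θ → ℝ≥0) (A : Θ → Matrix (Fin n) (Fin n) ℝ)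
    (G : Θ → Matrix (Fin n) (Fin m) ℝ) (Q : Θ → Matrix (Fin n) (Fin n) ℝ)
    (R : Θ → Matrix (Fin m) (Fin m) ℝ) (P : Θ → Matrix (Fin n) (Fin n) ℝ) :
    Θ → Matrix (Fin n ⊕ Fin m) (Fin n ⊕ Fin m) ℝ :=
  fun ℓ => Matrix.fromBlocks
    (-P ℓ + opT μ g A P ℓ + Q ℓ) (opG μ g A G P ℓ)ᵀ
    (opG μ g A G P ℓ) (opR μ g G R P ℓ)

/-- `P ∈ 𝓢𝓗_∞^n` solves the coupled algebraic Riccati equations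
`P = 𝓣_A(P) + Q - 𝓖(P)ᵀ 𝓡(P)⁻¹ 𝓖(P)` `μ`-a.e.  The inverse that occurs in the equation has to
exist `μ`-a.e. -/
structure IsRiccatiSolution {n m : ℕ} (μ : Measure Θ) (g : Θ → Θ → ℝ≥0)
    (A : Θ → Matrix (Fin n) (Fin n) ℝ) (G : Θ → Matrix (Fin n) (Fin m) ℝ)
    (Q : Θ → Matrix (Fin n) (Fin n) ℝ) (R : Θ → Matrix (Fin m) (Fin m) ℝ)
    (P : Θ → Matrix (Fin n) (Fin n) ℝ) : Prop where
  mem : MemSHInf μ P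
  invertible : ∀ᵐ ℓ ∂μ, IsUnit (opR μ g G R P ℓ)
  equation : ∀ᵐ ℓ ∂μ, P ℓ = opT μ g A P ℓ + Q ℓ
    - (opG μ g A G P ℓ)ᵀ * (opR μ g G R P ℓ)⁻¹ * opG μ g A G P ℓ

/-- `P` is a stabilizing solution of the coupled algebraic Riccati equations: it is a solution
and the feedback `u(k) = 𝓜(P)(ϑ(k)) x(k)` exponentially stabilizes `(A, G|𝔾)`. -/
structure IsStabilizingSolution {n m : ℕ} (μ : Measure Θ) (𝔾 : Kernel Θ Θ) [IsMarkovKernel 𝔾]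
    (g : Θ → Θ → ℝ≥0) (A : Θ → Matrix (Fin n) (Fin n) ℝ) (G : Θ → Matrix (Fin n) (Fin m) ℝ)
    (Q : Θ → Matrix (Fin n) (Fin n) ℝ) (R : Θ → Matrix (Fin m) (Fin m) ℝ)
    (P : Θ → Matrix (Fin n) (Fin n) ℝ) : Prop
    extends IsRiccatiSolution μ g A G Q R P where
  stabilizes : Stabilizes μ 𝔾 A G (opM μ g A G R P)

end MJLS

end

namespace MJLS

/-! ### Entrywise description of `𝓗_∞` -/

/-! The Riccati right-hand side is the value of a one-step minimization: with `cost` the quadratic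
cost of a control `u` under terminal weight `𝓔(P)`, completing the square gives `min_u cost = xᵀ
(riccatiMap P) x`, attained at `u = 𝓜(P) x`, as long as `𝓡(P)` is coercive. Hence `riccatiMap` is
monotone there. The block inequality says that the given matrix function, called `L` below, is a
strict subsolution: `xᵀLx + ξ(|x|² + |u|²) ≤ cost` for all `x`, `u`.

Existence: value iteration from `0` decreases because `riccatiMap 0 = Q ≤ 0`, and it stays above
`L`. Everything above `L` inherits `𝓡 ≥ ξ I`, so the monotone limit `P` is a solution with the sign
condition (`exists_riccati_solution_ge`).

Stability: `V = P - L` is a Lyapunov function of the closed loop. Comparing the costs for `P` and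
`L` at `u = 𝓜(P) x` shows that `V` drops by at least `ξ|x|²` per step
(`emss_opM_of_strict_subsolution`, `EMSS.of_lyapunov`).

Uniqueness: the difference `D` of two stabilizing solutions satisfies `D = Bᵀ 𝓔(D) A` with `A`, `B`
the two closed loops. Unrolling this `k` times bounds `D` by second moments that decay geometrically
(`eq_zero_of_coupled_stein`). -/

theorem abs_entry_le_norm {n m : ℕ} (M : Matrix (Fin n) (Fin m) ℝ) (i : Fin n) (j : Fin m) :
    |M i j| ≤ ‖M‖ := by
  have h := Matrix.l2_opNorm_mulVec M (EuclideanSpace.single j (1 : ℝ))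
  have h2 := PiLp.norm_apply_le
    ((EuclideanSpace.equiv (Fin n) ℝ).symm <| M *ᵥ (EuclideanSpace.single j (1 : ℝ))) i
  simp at h h2
  exact h2.trans h

theorem norm_le_of_abs_entry_le {n m : ℕ} {M : Matrix (Fin n) (Fin m) ℝ} {c : ℝ}
    (h : ∀ i j, |M i j| ≤ c) :
    ‖M‖ ≤ ∑ i : Fin n, ∑ j : Fin m, c * ‖Matrix.single i j (1 : ℝ)‖ := by
  have hM : M = ∑ i, ∑ j, M i j • Matrix.single i j (1 : ℝ) := by
    conv_lhs => rw [Matrix.matrix_eq_sum_single M]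
    simp
  conv_lhs => rw [hM]
  refine (norm_sum_le _ _).trans (Finset.sum_le_sum fun i _ => ?_)
  refine (norm_sum_le _ _).trans (Finset.sum_le_sum fun j _ => ?_)
  rw [norm_smul]
  gcongr
  exact h i j

variable {Θ : Type*} [MeasurableSpace Θ] {μ : Measure Θ} {n m k : ℕ}

theorem MemHInf.of_entries {Q : Θ → Matrix (Fin n) (Fin m) ℝ}
    (hm : ∀ i j, Measurable fun ℓ => Q ℓ i j) {c : ℝ} (hb : ∀ᵐ ℓ ∂μ, ∀ i j, |Q ℓ i j| ≤ c) :
    MemHInf μ Q :=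
  ⟨hm, _, hb.mono fun _ h => norm_le_of_abs_entry_le h⟩

theorem MemHInf.exists_entry_bound {Q : Θ → Matrix (Fin n) (Fin m) ℝ} (hQ : MemHInf μ Q) :
    ∃ c : ℝ, 0 ≤ c ∧ ∀ᵐ ℓ ∂μ, ∀ i j, |Q ℓ i j| ≤ c := by
  obtain ⟨c, hc⟩ := hQ.bounded
  exact ⟨max c 0, le_max_right _ _, hc.mono fun ℓ h i j =>
    (abs_entry_le_norm _ i j).trans (h.trans (le_max_left _ _))⟩

theorem MemHInf.add {U V : Θ → Matrix (Fin n) (Fin m) ℝ} (hU : MemHInf μ U) (hV : MemHInf μ V) :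
    MemHInf μ fun ℓ => U ℓ + V ℓ := by
  obtain ⟨a, ha⟩ := hU.bounded
  obtain ⟨b, hb⟩ := hV.bounded
  refine ⟨fun i j => (hU.measurable i j).add (hV.measurable i j), a + b, ?_⟩
  filter_upwards [ha, hb] with ℓ h1 h2
  exact (norm_add_le _ _).trans (add_le_add h1 h2)

theorem MemHInf.neg {U : Θ → Matrix (Fin n) (Fin m) ℝ} (hU : MemHInf μ U) :
    MemHInf μ fun ℓ => -U ℓ := by
  obtain ⟨a, ha⟩ := hU.bounded
  exact ⟨fun i j => (hU.measurable i j).neg, a, by simpa using ha⟩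

theorem MemHInf.sub {U V : Θ → Matrix (Fin n) (Fin m) ℝ} (hU : MemHInf μ U) (hV : MemHInf μ V) :
    MemHInf μ fun ℓ => U ℓ - V ℓ := by
  simpa only [sub_eq_add_neg] using hU.add hV.neg

theorem MemHInf.mul {U : Θ → Matrix (Fin n) (Fin m) ℝ} {V : Θ → Matrix (Fin m) (Fin k) ℝ}
    (hU : MemHInf μ U) (hV : MemHInf μ V) : MemHInf μ fun ℓ => U ℓ * V ℓ := by
  obtain ⟨a, ha⟩ := hU.bounded
  obtain ⟨b, hb⟩ := hV.bounded
  refine ⟨fun i j => ?_, a * b, ?_⟩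
  · simp only [Matrix.mul_apply]
    exact Finset.measurable_sum _ fun l _ => (hU.measurable i l).mul (hV.measurable l j)
  · filter_upwards [ha, hb] with ℓ h1 h2
    exact (Matrix.l2_opNorm_mul _ _).trans
      (mul_le_mul h1 h2 (norm_nonneg _) ((norm_nonneg _).trans h1))

theorem MemHInf.transpose {U : Θ → Matrix (Fin n) (Fin m) ℝ} (hU : MemHInf μ U) :
    MemHInf μ fun ℓ => (U ℓ)ᵀ := by
  obtain ⟨c, -, hc⟩ := hU.exists_entry_bound
  exact .of_entries (fun i j => hU.measurable j i) (hc.mono fun ℓ h i j => h j i)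

theorem measurable_det {M : Θ → Matrix (Fin n) (Fin n) ℝ}
    (hM : ∀ i j, Measurable fun ℓ => M ℓ i j) : Measurable fun ℓ => (M ℓ).det := by
  simp only [Matrix.det_apply]
  exact Finset.measurable_sum _ fun σ _ =>
    (Finset.measurable_prod _ fun i _ => hM (σ i) i).const_smul _

/-- Cramer's formula gives measurability everywhere: where the determinant vanishes, both its
inverse and `M⁻¹` take the value `0`. -/
theorem measurable_inv {M : Θ → Matrix (Fin n) (Fin n) ℝ}
    (hM : ∀ i j, Measurable fun ℓ => M ℓ i j) (i j : Fin n) :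
    Measurable fun ℓ => (M ℓ)⁻¹ i j := by
  simp only [Matrix.inv_def, Matrix.smul_apply, Ring.inverse_eq_inv', smul_eq_mul,
    Matrix.adjugate_apply]
  refine (measurable_det hM).inv.mul (measurable_det fun a b => ?_)
  simp only [Matrix.updateRow_apply]
  split_ifs
  · exact measurable_const
  · exact hM a b

/-! ### Quadratic forms and uniform positivity -/

theorem dotProduct_self_nonneg' {ι : Type*} [Fintype ι] (x : ι → ℝ) : 0 ≤ x ⬝ᵥ x :=
  Finset.sum_nonneg fun i _ => mul_self_nonneg (x i)

theorem sq_le_dotProduct_self {ι : Type*} [Fintype ι] (x : ι → ℝ) (i : ι) :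
    x i * x i ≤ x ⬝ᵥ x :=
  Finset.single_le_sum (f := fun i => x i * x i) (fun i _ => mul_self_nonneg (x i))
    (Finset.mem_univ i)

theorem posSemidef_sub_smul_one_iff {ι : Type*} [Fintype ι] [DecidableEq ι] {M : Matrix ι ι ℝ}
    {ξ : ℝ} (hM : M.IsSymm) :
    (M - ξ • (1 : Matrix ι ι ℝ)).PosSemidef ↔ ∀ x, ξ * (x ⬝ᵥ x) ≤ x ⬝ᵥ M *ᵥ x := by
  have hH : (M - ξ • (1 : Matrix ι ι ℝ)).IsHermitian := by
    have h : (M - ξ • (1 : Matrix ι ι ℝ))ᵀ = M - ξ • (1 : Matrix ι ι ℝ) := by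
      simp [hM.eq]
    rw [Matrix.IsHermitian, Matrix.conjTranspose_eq_transpose_of_trivial, h]
  rw [Matrix.posSemidef_iff_dotProduct_mulVec]
  simp only [hH, true_and, star_trivial, Matrix.sub_mulVec, dotProduct_sub, Matrix.smul_mulVec,
    Matrix.one_mulVec, dotProduct_smul, smul_eq_mul, sub_nonneg]

theorem le_dotProduct_mulVec_of_posSemidef {ι : Type*} [Fintype ι] [DecidableEq ι]
    {M : Matrix ι ι ℝ} {ξ : ℝ} (h : (M - ξ • (1 : Matrix ι ι ℝ)).PosSemidef) (x : ι → ℝ) :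
    ξ * (x ⬝ᵥ x) ≤ x ⬝ᵥ M *ᵥ x := by
  have := h.dotProduct_mulVec_nonneg x
  simpa only [star_trivial, Matrix.sub_mulVec, dotProduct_sub, Matrix.smul_mulVec,
    Matrix.one_mulVec, dotProduct_smul, smul_eq_mul, sub_nonneg] using this

theorem isUnit_of_pos {M : Matrix (Fin n) (Fin n) ℝ} {ξ : ℝ} (hξ : 0 < ξ)
    (h : ∀ x, ξ * (x ⬝ᵥ x) ≤ x ⬝ᵥ M *ᵥ x) : IsUnit M := by
  rw [← Matrix.mulVec_injective_iff_isUnit]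
  intro x y hxy
  have h0 : M *ᵥ (x - y) = 0 := by rw [Matrix.mulVec_sub, sub_eq_zero]; exact hxy
  have h1 := h (x - y)
  rw [h0, dotProduct_zero] at h1
  have h2 : (x - y) ⬝ᵥ (x - y) = 0 :=
    le_antisymm (by nlinarith) (dotProduct_self_nonneg' _)
  exact sub_eq_zero.1 (dotProduct_self_eq_zero.1 h2)

/-- Coercivity is tested on the `j`-th column `u` of `M⁻¹`, for which `M u = e_j`: then `ξ|u|² ≤
u_j`, so `u_j ≤ ξ⁻¹` and every `u_i² ≤ ξ⁻²`. -/
theorem abs_inv_entry_le {M : Matrix (Fin n) (Fin n) ℝ} {ξ : ℝ} (hξ : 0 < ξ)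
    (h : ∀ x, ξ * (x ⬝ᵥ x) ≤ x ⬝ᵥ M *ᵥ x) (i j : Fin n) : |M⁻¹ i j| ≤ ξ⁻¹ := by
  have hu := (Matrix.isUnit_iff_isUnit_det _).1 (isUnit_of_pos hξ h)
  set u : Fin n → ℝ := fun a => M⁻¹ a j with hu'
  have hMu : M *ᵥ u = Pi.single j 1 := by
    have : u = M⁻¹ *ᵥ Pi.single j 1 := by ext a; simp [u]
    rw [this, Matrix.mulVec_mulVec, Matrix.mul_nonsing_inv _ hu, Matrix.one_mulVec]
  have h1 := h u
  rw [hMu, dotProduct_single, mul_one] at h1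
  have h2 : ξ * (u j * u j) ≤ u j := (mul_le_mul_of_nonneg_left (sq_le_dotProduct_self u j) hξ.le).trans h1
  have h3 : ξ * (u i * u i) ≤ u j := (mul_le_mul_of_nonneg_left (sq_le_dotProduct_self u i) hξ.le).trans h1
  have h4 : u j ≤ ξ⁻¹ := by
    by_contra! hlt
    have h5 : 0 < u j := (inv_pos.2 hξ).trans hlt
    have h6 : 1 < ξ * u j := by
      have := mul_lt_mul_of_pos_left hlt hξ
      rwa [mul_inv_cancel₀ hξ.ne'] at this
    nlinarith
  have h5 : u i * u i ≤ ξ⁻¹ * ξ⁻¹ := by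
    have := mul_le_mul_of_nonneg_left (h3.trans h4) (inv_pos.2 hξ).le
    rwa [← mul_assoc, inv_mul_cancel₀ hξ.ne', one_mul] at this
  exact abs_le_of_sq_le_sq (by simpa only [sq] using h5) (inv_pos.2 hξ).le

theorem MemHInf.inv {M : Θ → Matrix (Fin n) (Fin n) ℝ} (hM : MemHInf μ M) {ξ : ℝ} (hξ : 0 < ξ)
    (h : ∀ᵐ ℓ ∂μ, ∀ x, ξ * (x ⬝ᵥ x) ≤ x ⬝ᵥ M ℓ *ᵥ x) : MemHInf μ fun ℓ => (M ℓ)⁻¹ :=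
  .of_entries (measurable_inv hM.measurable) (h.mono fun _ h i j => abs_inv_entry_le hξ h i j)

theorem dotProduct_mulVec_eq_sum {ι κ : Type*} [Fintype ι] [Fintype κ] (M : Matrix ι κ ℝ)
    (x : ι → ℝ) (y : κ → ℝ) : x ⬝ᵥ M *ᵥ y = ∑ i, ∑ j, x i * y j * M i j := by
  simp only [dotProduct, Matrix.mulVec, Finset.mul_sum]
  exact Finset.sum_congr rfl fun i _ => Finset.sum_congr rfl fun j _ => by ring

/-- The additive bound, rather than `|x||y|`, is what later lets the estimate split into one second
moment for each of two systems. -/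
theorem MemHInf.exists_form_bound {V : Θ → Matrix (Fin n) (Fin n) ℝ} (hV : MemHInf μ V) :
    ∃ c : ℝ, 0 ≤ c ∧ ∀ᵐ ℓ ∂μ, ∀ x y, |x ⬝ᵥ V ℓ *ᵥ y| ≤ c * (x ⬝ᵥ x + y ⬝ᵥ y) := by
  obtain ⟨c, hc0, hc⟩ := hV.exists_entry_bound
  refine ⟨∑ _i : Fin n, ∑ _j : Fin n, c, by positivity, hc.mono fun ℓ h x y => ?_⟩
  rw [dotProduct_mulVec_eq_sum]
  simp only [Finset.sum_mul]
  refine (Finset.abs_sum_le_sum_abs _ _).trans (Finset.sum_le_sum fun i _ => ?_)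
  refine (Finset.abs_sum_le_sum_abs _ _).trans (Finset.sum_le_sum fun j _ => ?_)
  rw [abs_mul, mul_comm]
  refine mul_le_mul (h i j) ?_ (abs_nonneg _) hc0
  have h1 := sq_le_dotProduct_self x i
  have h2 := sq_le_dotProduct_self y j
  rw [abs_le]
  constructor <;> nlinarith [sq_nonneg (x i + y j), sq_nonneg (x i - y j)]

/-! ### The operator `𝓔` -/

section opE

variable {𝔾 : Kernel Θ Θ} {g : Θ → Θ → ℝ≥0}

theorem HasDensity.absolutelyContinuous (hg : HasDensity μ 𝔾 g) (ℓ : Θ) : 𝔾 ℓ ≪ μ := by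
  rw [(hg ℓ).2]
  exact withDensity_absolutelyContinuous _ _

/-- Since `𝔾 ℓ ≪ μ` for each `ℓ`, no exceptional set of `ℓ` appears: `𝓔` turns almost-everywhere
information into statements valid at every point. -/
theorem HasDensity.ae (hg : HasDensity μ 𝔾 g) {p : Θ → Prop} (h : ∀ᵐ t ∂μ, p t) (ℓ : Θ) :
    ∀ᵐ t ∂𝔾 ℓ, p t :=
  (hg.absolutelyContinuous ℓ).ae_le h

theorem opE_apply (hg : HasDensity μ 𝔾 g) (U : Θ → Matrix (Fin n) (Fin n) ℝ) (ℓ : Θ)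
    (i j : Fin n) : opE μ g U ℓ i j = ∫ t, U t i j ∂𝔾 ℓ := by
  rw [(hg ℓ).2, integral_withDensity_eq_integral_smul (hg ℓ).1]
  rfl

theorem opE_isSymm {U : Θ → Matrix (Fin n) (Fin n) ℝ} (h : ∀ ℓ, (U ℓ).IsSymm) (ℓ : Θ) :
    (opE μ g U ℓ).IsSymm := by
  ext i j
  simp [opE, fun t => (h t).apply]

variable [IsMarkovKernel 𝔾]

theorem MemHInf.integrable_entry (hg : HasDensity μ 𝔾 g) {U : Θ → Matrix (Fin n) (Fin m) ℝ}
    (hU : MemHInf μ U) (ℓ : Θ) (i : Fin n) (j : Fin m) : Integrable (fun t => U t i j) (𝔾 ℓ) := by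
  obtain ⟨c, -, hc⟩ := hU.exists_entry_bound
  exact Integrable.of_bound (hU.measurable i j).aestronglyMeasurable c
    ((hg.ae hc ℓ).mono fun t h => h i j)

theorem MemHInf.opE (hg : HasDensity μ 𝔾 g) {U : Θ → Matrix (Fin n) (Fin n) ℝ}
    (hU : MemHInf μ U) : MemHInf μ (opE μ g U) := by
  obtain ⟨c, -, hc⟩ := hU.exists_entry_bound
  refine .of_entries (c := c) (fun i j => ?_) (Eventually.of_forall fun ℓ i j => ?_)
  -- The density is measurable only in its second argument, so measurability in `ℓ` comes from the
  -- kernel `𝔾`.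
  · simp only [opE_apply hg]
    exact (hU.measurable i j).stronglyMeasurable.integral_kernel.measurable
  · rw [opE_apply hg]
    have := norm_integral_le_of_norm_le_const (μ := 𝔾 ℓ) (f := fun t => U t i j) (C := c)
      ((hg.ae hc ℓ).mono fun t h => h i j)
    simpa using this

theorem MemHInf.integrable_form (hg : HasDensity μ 𝔾 g) {U : Θ → Matrix (Fin n) (Fin n) ℝ}
    (hU : MemHInf μ U) (ℓ : Θ) (x y : Fin n → ℝ) :
    Integrable (fun t => x ⬝ᵥ U t *ᵥ y) (𝔾 ℓ) := by
  simp only [dotProduct_mulVec_eq_sum]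
  exact integrable_finsetSum _ fun i _ => integrable_finsetSum _ fun j _ =>
    (hU.integrable_entry hg ℓ i j).const_mul _

theorem dotProduct_opE_mulVec (hg : HasDensity μ 𝔾 g) {U : Θ → Matrix (Fin n) (Fin n) ℝ}
    (hU : MemHInf μ U) (ℓ : Θ) (x y : Fin n → ℝ) :
    x ⬝ᵥ opE μ g U ℓ *ᵥ y = ∫ t, x ⬝ᵥ U t *ᵥ y ∂𝔾 ℓ := by
  simp only [dotProduct_mulVec_eq_sum]
  rw [integral_finsetSum _ fun i _ => integrable_finsetSum _ fun j _ =>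
    (hU.integrable_entry hg ℓ i j).const_mul _]
  refine Finset.sum_congr rfl fun i _ => ?_
  rw [integral_finsetSum _ fun j _ => (hU.integrable_entry hg ℓ i j).const_mul _]
  refine Finset.sum_congr rfl fun j _ => ?_
  rw [integral_const_mul, opE_apply hg]

theorem opE_mono (hg : HasDensity μ 𝔾 g) {U V : Θ → Matrix (Fin n) (Fin n) ℝ}
    (hU : MemHInf μ U) (hV : MemHInf μ V) (h : ∀ᵐ t ∂μ, ∀ x, x ⬝ᵥ U t *ᵥ x ≤ x ⬝ᵥ V t *ᵥ x)
    (ℓ : Θ) (x : Fin n → ℝ) : x ⬝ᵥ opE μ g U ℓ *ᵥ x ≤ x ⬝ᵥ opE μ g V ℓ *ᵥ x := by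
  rw [dotProduct_opE_mulVec hg hU, dotProduct_opE_mulVec hg hV]
  exact integral_mono_ae (hU.integrable_form hg ℓ x x) (hV.integrable_form hg ℓ x x)
    ((hg.ae h ℓ).mono fun t ht => ht x)

theorem opE_sub (hg : HasDensity μ 𝔾 g) {U V : Θ → Matrix (Fin n) (Fin n) ℝ}
    (hU : MemHInf μ U) (hV : MemHInf μ V) (ℓ : Θ) :
    opE μ g (fun t => U t - V t) ℓ = opE μ g U ℓ - opE μ g V ℓ := by
  ext i j
  simp only [Matrix.sub_apply, opE_apply hg]
  exact integral_sub (hU.integrable_entry hg ℓ i j) (hV.integrable_entry hg ℓ i j)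

end opE

end MJLS

namespace MJLS

/-! ### Completion of squares -/

section Cost

variable {n m p : ℕ}

theorem dotProduct_transpose_mul_mulVec {n' : ℕ} (S : Matrix (Fin n) (Fin m) ℝ)
    (E : Matrix (Fin n) (Fin n') ℝ) (T : Matrix (Fin n') (Fin p) ℝ) (x : Fin m → ℝ)
    (y : Fin p → ℝ) : x ⬝ᵥ (Sᵀ * E * T) *ᵥ y = (S *ᵥ x) ⬝ᵥ E *ᵥ (T *ᵥ y) := by
  rw [← Matrix.mulVec_mulVec, ← Matrix.mulVec_mulVec, Matrix.dotProduct_mulVec,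
    Matrix.vecMul_transpose]

theorem dotProduct_mulVec_comm_of_isSymm {E : Matrix (Fin n) (Fin n) ℝ} (hE : E.IsSymm)
    (x y : Fin n → ℝ) : x ⬝ᵥ E *ᵥ y = y ⬝ᵥ E *ᵥ x := by
  rw [Matrix.dotProduct_mulVec, ← Matrix.mulVec_transpose, hE.eq, dotProduct_comm]

/-- The one-step cost of the control `u` in the state `x`, with terminal weight `E`. -/
def cost (A : Matrix (Fin n) (Fin n) ℝ) (G : Matrix (Fin n) (Fin m) ℝ)
    (Q : Matrix (Fin n) (Fin n) ℝ) (R : Matrix (Fin m) (Fin m) ℝ) (E : Matrix (Fin n) (Fin n) ℝ)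
    (x : Fin n → ℝ) (u : Fin m → ℝ) : ℝ :=
  (A *ᵥ x + G *ᵥ u) ⬝ᵥ E *ᵥ (A *ᵥ x + G *ᵥ u) + x ⬝ᵥ Q *ᵥ x + u ⬝ᵥ R *ᵥ u

variable {A : Matrix (Fin n) (Fin n) ℝ} {G : Matrix (Fin n) (Fin m) ℝ}
  {Q : Matrix (Fin n) (Fin n) ℝ} {R : Matrix (Fin m) (Fin m) ℝ} {E : Matrix (Fin n) (Fin n) ℝ}

theorem cost_eq_expand (hE : E.IsSymm) (x : Fin n → ℝ) (u : Fin m → ℝ) :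
    cost A G Q R E x u = x ⬝ᵥ (Aᵀ * E * A + Q) *ᵥ x + 2 * (u ⬝ᵥ (Gᵀ * E * A) *ᵥ x)
      + u ⬝ᵥ (R + Gᵀ * E * G) *ᵥ u := by
  simp only [cost, Matrix.add_mulVec, dotProduct_add, add_dotProduct, Matrix.mulVec_add,
    dotProduct_transpose_mul_mulVec]
  rw [dotProduct_mulVec_comm_of_isSymm hE (A *ᵥ x) (G *ᵥ u)]
  ring

/-- Only invertibility of `R + Gᵀ E G` enters, not its sign, because the identity is algebraic: the
minimizer `f` solves `W f = -K x`. -/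
theorem cost_eq_add_square (hE : E.IsSymm) (hR : R.IsSymm) (hW : IsUnit (R + Gᵀ * E * G))
    (x : Fin n → ℝ) (u : Fin m → ℝ) :
    cost A G Q R E x u = x ⬝ᵥ (Aᵀ * E * A + Q
        - (Gᵀ * E * A)ᵀ * (R + Gᵀ * E * G)⁻¹ * (Gᵀ * E * A)) *ᵥ x
      + (u - (-((R + Gᵀ * E * G)⁻¹ * (Gᵀ * E * A))) *ᵥ x) ⬝ᵥ (R + Gᵀ * E * G) *ᵥ
        (u - (-((R + Gᵀ * E * G)⁻¹ * (Gᵀ * E * A))) *ᵥ x) := by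
  rw [cost_eq_expand hE]
  have hWs : (R + Gᵀ * E * G).IsSymm := by
    refine hR.add ?_
    simp [Matrix.IsSymm, Matrix.transpose_mul, hE.eq, Matrix.mul_assoc]
  set W := R + Gᵀ * E * G
  set K := Gᵀ * E * A
  have hF : W *ᵥ (-(W⁻¹ * K)) *ᵥ x = -(K *ᵥ x) := by
    rw [Matrix.neg_mulVec, Matrix.mulVec_neg, Matrix.mulVec_mulVec,
      Matrix.mul_nonsing_inv_cancel_left _ _ ((Matrix.isUnit_iff_isUnit_det _).1 hW)]
  have hK : x ⬝ᵥ (Kᵀ * W⁻¹ * K) *ᵥ x = -((-(W⁻¹ * K)) *ᵥ x ⬝ᵥ K *ᵥ x) := by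
    rw [dotProduct_transpose_mul_mulVec, Matrix.neg_mulVec, neg_dotProduct, neg_neg,
      dotProduct_comm, Matrix.mulVec_mulVec]
  set f := (-(W⁻¹ * K)) *ᵥ x
  have h1 : f ⬝ᵥ W *ᵥ u = -(u ⬝ᵥ K *ᵥ x) := by
    rw [dotProduct_mulVec_comm_of_isSymm hWs, hF, dotProduct_neg]
  simp only [Matrix.sub_mulVec, dotProduct_sub, sub_dotProduct, Matrix.mulVec_sub, hF, h1, hK,
    dotProduct_neg]
  ring

/-- Taking the state to be zero isolates the weight `R + Gᵀ E G`, so bounds on `cost` yield bounds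
on `𝓡`. -/
theorem cost_zero_left (u : Fin m → ℝ) :
    cost A G Q R E 0 u = u ⬝ᵥ (R + Gᵀ * E * G) *ᵥ u := by
  simp only [cost, Matrix.mulVec_zero, zero_add, dotProduct_zero, Matrix.add_mulVec,
    dotProduct_add, dotProduct_transpose_mul_mulVec, add_zero]
  ring

/-! ### Continuity, and recovery of entries from quadratic forms -/

theorem continuous_dotProduct_mulVec {ι κ : Type*} [Fintype ι] [Fintype κ] (x : ι → ℝ)
    (y : κ → ℝ) : Continuous fun M : Matrix ι κ ℝ => x ⬝ᵥ M *ᵥ y := by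
  fun_prop

theorem continuousAt_inv_of_isUnit {M : Matrix (Fin n) (Fin n) ℝ} (hM : IsUnit M) :
    ContinuousAt (fun M : Matrix (Fin n) (Fin n) ℝ => M⁻¹) M := by
  simp only [Matrix.inv_def, Ring.inverse_eq_inv']
  have hd : M.det ≠ 0 := ((Matrix.isUnit_iff_isUnit_det _).1 hM).ne_zero
  exact (ContinuousAt.inv₀ (continuous_id.matrix_det).continuousAt hd).smul
    (continuous_id.matrix_adjugate).continuousAt

theorem entry_eq_polarization {M : Matrix (Fin n) (Fin n) ℝ} (hM : M.IsSymm) (i j : Fin n) :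
    M i j = ((Pi.single i 1 + Pi.single j 1) ⬝ᵥ M *ᵥ (Pi.single i 1 + Pi.single j 1)
      - Pi.single i 1 ⬝ᵥ M *ᵥ Pi.single i 1 - Pi.single j 1 ⬝ᵥ M *ᵥ Pi.single j 1) / 2 := by
  simp only [Matrix.mulVec_add, dotProduct_add, add_dotProduct, Matrix.mulVec_single_one,
    single_one_dotProduct, Matrix.col_apply]
  rw [hM.apply i j]
  ring

theorem abs_entry_le_of_form_bound {M : Matrix (Fin n) (Fin n) ℝ} (hM : M.IsSymm) {c : ℝ}
    (h : ∀ x, |x ⬝ᵥ M *ᵥ x| ≤ c * (x ⬝ᵥ x)) (i j : Fin n) : |M i j| ≤ 3 * c := by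
  have hs : ∀ i : Fin n, (Pi.single i (1 : ℝ) : Fin n → ℝ) ⬝ᵥ Pi.single i 1 = 1 := by simp
  have hi := h (Pi.single i 1)
  have hj := h (Pi.single j 1)
  have hij := h (Pi.single i 1 + Pi.single j 1)
  have hc : 0 ≤ c := by
    have := (abs_nonneg _).trans hi
    rwa [hs, mul_one] at this
  -- `|e_i - e_j|² ≥ 0` gives `|e_i + e_j|² ≤ 4`, including `i = j`; polarization then yields `(4c +
  -- c + c)/2 = 3c`.
  have hn : (Pi.single i (1 : ℝ) + Pi.single j 1 : Fin n → ℝ) ⬝ᵥ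
      (Pi.single i 1 + Pi.single j 1) ≤ 4 := by
    have h0 := dotProduct_self_nonneg' (Pi.single i (1 : ℝ) - Pi.single j 1 : Fin n → ℝ)
    simp only [sub_dotProduct, dotProduct_sub, add_dotProduct, dotProduct_add, hs] at h0 ⊢
    linarith
  rw [hs, mul_one] at hi hj
  replace hij := hij.trans (mul_le_mul_of_nonneg_left hn hc)
  rw [entry_eq_polarization hM]
  rw [abs_le] at *
  constructor <;> linarith

end Cost

/-! ### Monotone limits in `𝓢𝓗_∞` -/

variable {Θ : Type*} [MeasurableSpace Θ] {μ : Measure Θ} {n m : ℕ}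

/-- For each `x` the forms are monotone and bounded, hence convergent, and polarization carries this
to the entries. The bound uniform in `k` serves dominated convergence under `𝓔`. -/
theorem MemSHInf.exists_antitone_limit {P : ℕ → Θ → Matrix (Fin n) (Fin n) ℝ}
    {L : Θ → Matrix (Fin n) (Fin n) ℝ} (hP : ∀ k, MemSHInf μ (P k)) (hL : MemHInf μ L)
    (hanti : ∀ k, ∀ᵐ ℓ ∂μ, ∀ x, x ⬝ᵥ P (k + 1) ℓ *ᵥ x ≤ x ⬝ᵥ P k ℓ *ᵥ x)
    (hlow : ∀ k, ∀ᵐ ℓ ∂μ, ∀ x, x ⬝ᵥ L ℓ *ᵥ x ≤ x ⬝ᵥ P k ℓ *ᵥ x) :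
    ∃ P' : Θ → Matrix (Fin n) (Fin n) ℝ, MemSHInf μ P' ∧
      (∀ᵐ ℓ ∂μ, Tendsto (fun k => P k ℓ) atTop (nhds (P' ℓ))) ∧
      ∃ c : ℝ, ∀ k, ∀ᵐ ℓ ∂μ, ∀ i j, |P k ℓ i j| ≤ c := by
  obtain ⟨a, ha0, ha⟩ := hL.exists_form_bound
  obtain ⟨b, hb0, hb⟩ := (hP 0).toMemHInf.exists_form_bound
  have hA : ∀ᵐ ℓ ∂μ, ∀ x, Antitone fun k => x ⬝ᵥ P k ℓ *ᵥ x :=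
    (ae_all_iff.2 hanti).mono fun ℓ h x => antitone_nat_of_succ_le fun k => h k x
  have hB : ∀ᵐ ℓ ∂μ, ∀ k x, |x ⬝ᵥ P k ℓ *ᵥ x| ≤ (2 * (a + b)) * (x ⬝ᵥ x) := by
    filter_upwards [hA, ae_all_iff.2 hlow, ha, hb] with ℓ h1 h2 h3 h4 k x
    have e1 : x ⬝ᵥ P k ℓ *ᵥ x ≤ x ⬝ᵥ P 0 ℓ *ᵥ x := h1 x (Nat.zero_le k)
    have e2 := h2 k x
    have e3 := abs_le.1 (h3 x x)
    have e4 := abs_le.1 (h4 x x)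
    have e5 := mul_nonneg ha0 (dotProduct_self_nonneg' x)
    have e6 := mul_nonneg hb0 (dotProduct_self_nonneg' x)
    rw [abs_le]
    constructor <;> nlinarith
  have hC : ∀ᵐ ℓ ∂μ, ∀ k i j, |P k ℓ i j| ≤ 3 * (2 * (a + b)) :=
    hB.mono fun ℓ h k i j => abs_entry_le_of_form_bound ((hP k).symm ℓ) (h k) i j
  have hconv : ∀ᵐ ℓ ∂μ, ∀ i j, ∃ l, Tendsto (fun k => P k ℓ i j) atTop (nhds l) := by
    filter_upwards [hA, hB] with ℓ h1 h2 i j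
    have hx : ∀ x, ∃ l, Tendsto (fun k => x ⬝ᵥ P k ℓ *ᵥ x) atTop (nhds l) := fun x =>
      ⟨_, tendsto_atTop_ciInf (h1 x) ⟨-((2 * (a + b)) * (x ⬝ᵥ x)), by
        rintro _ ⟨k, rfl⟩
        exact (abs_le.1 (h2 k x)).1⟩⟩
    obtain ⟨l1, h1⟩ := hx (Pi.single i 1 + Pi.single j 1)
    obtain ⟨l2, h2⟩ := hx (Pi.single i 1)
    obtain ⟨l3, h3⟩ := hx (Pi.single j 1)
    refine ⟨_, (((h1.sub h2).sub h3).div_const 2).congr fun k => ?_⟩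
    rw [entry_eq_polarization ((hP k).symm ℓ)]
  choose f hfm hf using fun i j => measurable_limit_of_tendsto_metrizable_ae
    (fun k => ((hP k).measurable i j).aemeasurable) (hconv.mono fun ℓ h => h i j)
  have hf' : ∀ᵐ ℓ ∂μ, ∀ i j, Tendsto (fun k => P k ℓ i j) atTop (nhds (f i j ℓ)) :=
    ae_all_iff.2 fun i => ae_all_iff.2 fun j => hf i j
  -- The measurable limits `f i j` are symmetric only almost everywhere; averaging makes the limit
  -- symmetric at every point, as `MemSHInf` demands.
  have hlim : ∀ᵐ ℓ ∂μ, ∀ i j, Tendsto (fun k => P k ℓ i j) atTop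
      (nhds ((f i j ℓ + f j i ℓ) / 2)) := by
    filter_upwards [hf'] with ℓ h i j
    have h2 : Tendsto (fun k => P k ℓ i j) atTop (nhds (f j i ℓ)) :=
      (h j i).congr fun k => (((hP k).symm ℓ).apply i j)
    have h3 := tendsto_nhds_unique (h i j) h2
    have h4 : (f i j ℓ + f j i ℓ) / 2 = f i j ℓ := by rw [← h3]; ring
    rw [h4]
    exact h i j
  refine ⟨fun ℓ => Matrix.of fun i j => (f i j ℓ + f j i ℓ) / 2, ⟨.of_entries (fun i j => ?_)
    (c := 3 * (2 * (a + b))) ?_, fun ℓ => ?_⟩, ?_, 3 * (2 * (a + b)), ?_⟩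
  · exact ((hfm i j).add (hfm j i)).div_const 2
  · filter_upwards [hlim, hC] with ℓ h1 h2 i j
    exact le_of_tendsto (h1 i j).abs (Eventually.of_forall fun k => h2 k i j)
  · ext i j
    simp [add_comm]
  · filter_upwards [hlim] with ℓ h
    exact tendsto_pi_nhds.2 fun i => tendsto_pi_nhds.2 fun j => h i j
  · exact ae_all_iff.1 hC

theorem tendsto_opE {𝔾 : Kernel Θ Θ} [IsMarkovKernel 𝔾] {g : Θ → Θ → ℝ≥0}
    (hg : HasDensity μ 𝔾 g) {P : ℕ → Θ → Matrix (Fin n) (Fin n) ℝ}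
    {P' : Θ → Matrix (Fin n) (Fin n) ℝ} (hP : ∀ k, MemHInf μ (P k)) {c : ℝ}
    (hc : ∀ k, ∀ᵐ ℓ ∂μ, ∀ i j, |P k ℓ i j| ≤ c)
    (hlim : ∀ᵐ ℓ ∂μ, Tendsto (fun k => P k ℓ) atTop (nhds (P' ℓ))) (ℓ : Θ) :
    Tendsto (fun k => opE μ g (P k) ℓ) atTop (nhds (opE μ g P' ℓ)) := by
  refine tendsto_pi_nhds.2 fun i => tendsto_pi_nhds.2 fun j => ?_
  simp only [opE_apply hg]
  refine tendsto_integral_of_dominated_convergence (fun _ => c)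
    (fun k => ((hP k).measurable i j).aestronglyMeasurable) (integrable_const c)
    (fun k => (hg.ae (hc k) ℓ).mono fun t h => h i j) ((hg.ae hlim ℓ).mono fun t h => ?_)
  exact (tendsto_pi_nhds.1 ((tendsto_pi_nhds.1 h) i)) j

end MJLS

namespace MJLS

/-! ### Value iteration for the Riccati equation -/

section Riccati

variable {Θ : Type*} [MeasurableSpace Θ] {n m : ℕ}

/-- The right-hand side of the coupled algebraic Riccati equations. -/
noncomputable def riccatiMap (μ : Measure Θ) (g : Θ → Θ → ℝ≥0)
    (A : Θ → Matrix (Fin n) (Fin n) ℝ) (G : Θ → Matrix (Fin n) (Fin m) ℝ)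
    (Q : Θ → Matrix (Fin n) (Fin n) ℝ) (R : Θ → Matrix (Fin m) (Fin m) ℝ)
    (P : Θ → Matrix (Fin n) (Fin n) ℝ) : Θ → Matrix (Fin n) (Fin n) ℝ :=
  fun ℓ => opT μ g A P ℓ + Q ℓ - (opG μ g A G P ℓ)ᵀ * (opR μ g G R P ℓ)⁻¹ * opG μ g A G P ℓ

variable {μ : Measure Θ} {𝔾 : Kernel Θ Θ} [IsMarkovKernel 𝔾] {g : Θ → Θ → ℝ≥0}
  {A : Θ → Matrix (Fin n) (Fin n) ℝ} {G : Θ → Matrix (Fin n) (Fin m) ℝ}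
  {Q : Θ → Matrix (Fin n) (Fin n) ℝ} {R : Θ → Matrix (Fin m) (Fin m) ℝ}
  {P U V : Θ → Matrix (Fin n) (Fin n) ℝ}

theorem opR_isSymm (hR : ∀ ℓ, (R ℓ).IsSymm) (hP : ∀ ℓ, (P ℓ).IsSymm) (ℓ : Θ) :
    (opR μ g G R P ℓ).IsSymm := by
  refine (hR ℓ).add ?_
  simp [opT, Matrix.IsSymm, Matrix.transpose_mul, (opE_isSymm hP ℓ).eq, Matrix.mul_assoc]

theorem MemHInf.opG (hg : HasDensity μ 𝔾 g) (hA : MemHInf μ A) (hG : MemHInf μ G)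
    (hP : MemHInf μ P) : MemHInf μ (MJLS.opG μ g A G P) :=
  (hG.transpose.mul (hP.opE hg)).mul hA

theorem MemHInf.opR (hg : HasDensity μ 𝔾 g) (hG : MemHInf μ G) (hR : MemHInf μ R)
    (hP : MemHInf μ P) : MemHInf μ (MJLS.opR μ g G R P) :=
  hR.add ((hG.transpose.mul (hP.opE hg)).mul hG)

theorem MemHInf.opM (hg : HasDensity μ 𝔾 g) (hA : MemHInf μ A) (hG : MemHInf μ G)
    (hR : MemHInf μ R) (hP : MemHInf μ P) {ξ : ℝ} (hξ : 0 < ξ)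
    (h : ∀ᵐ ℓ ∂μ, ∀ u, ξ * (u ⬝ᵥ u) ≤ u ⬝ᵥ MJLS.opR μ g G R P ℓ *ᵥ u) :
    MemHInf μ (MJLS.opM μ g A G R P) :=
  (((MemHInf.opR hg hG hR hP).inv hξ h).mul (MemHInf.opG hg hA hG hP)).neg

theorem MemSHInf.riccatiMap (hg : HasDensity μ 𝔾 g) (hA : MemHInf μ A) (hG : MemHInf μ G)
    (hQ : MemSHInf μ Q) (hR : MemSHInf μ R) (hP : MemSHInf μ P) {ξ : ℝ} (hξ : 0 < ξ)
    (h : ∀ᵐ ℓ ∂μ, ∀ u, ξ * (u ⬝ᵥ u) ≤ u ⬝ᵥ opR μ g G R P ℓ *ᵥ u) :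
    MemSHInf μ (riccatiMap μ g A G Q R P) := by
  have hK := MemHInf.opG hg hA hG hP.toMemHInf
  refine ⟨((((hA.transpose.mul (hP.opE hg)).mul hA).add hQ.toMemHInf).sub
    ((hK.transpose.mul ((MemHInf.opR hg hG hR.toMemHInf hP.toMemHInf).inv hξ h)).mul hK)), fun ℓ => ?_⟩
  have hW := opR_isSymm (μ := μ) (g := g) (G := G) hR.symm hP.symm ℓ
  simp only [Matrix.IsSymm, MJLS.riccatiMap, opT, Matrix.transpose_sub, Matrix.transpose_add,
    Matrix.transpose_mul, Matrix.transpose_transpose, (opE_isSymm hP.symm ℓ).eq,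
    (hQ.symm ℓ).eq, hW.inv.eq, Matrix.mul_assoc]

theorem cost_opE_eq_add_square (hR : ∀ ℓ, (R ℓ).IsSymm) (hP : ∀ ℓ, (P ℓ).IsSymm) {ℓ : Θ}
    (hW : IsUnit (opR μ g G R P ℓ)) (x : Fin n → ℝ) (u : Fin m → ℝ) :
    cost (A ℓ) (G ℓ) (Q ℓ) (R ℓ) (opE μ g P ℓ) x u = x ⬝ᵥ riccatiMap μ g A G Q R P ℓ *ᵥ x
      + (u - opM μ g A G R P ℓ *ᵥ x) ⬝ᵥ opR μ g G R P ℓ *ᵥ (u - opM μ g A G R P ℓ *ᵥ x) :=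
  cost_eq_add_square (opE_isSymm hP ℓ) (hR ℓ) hW x u

theorem cost_opM (hR : ∀ ℓ, (R ℓ).IsSymm) (hP : ∀ ℓ, (P ℓ).IsSymm) {ℓ : Θ}
    (hW : IsUnit (opR μ g G R P ℓ)) (x : Fin n → ℝ) :
    cost (A ℓ) (G ℓ) (Q ℓ) (R ℓ) (opE μ g P ℓ) x (opM μ g A G R P ℓ *ᵥ x)
      = x ⬝ᵥ riccatiMap μ g A G Q R P ℓ *ᵥ x := by
  rw [cost_opE_eq_add_square hR hP hW, sub_self, zero_dotProduct, add_zero]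

theorem cost_opE_mono (hg : HasDensity μ 𝔾 g) (hU : MemHInf μ U) (hV : MemHInf μ V)
    (h : ∀ᵐ t ∂μ, ∀ x, x ⬝ᵥ U t *ᵥ x ≤ x ⬝ᵥ V t *ᵥ x) (ℓ : Θ) (x : Fin n → ℝ) (u : Fin m → ℝ) :
    cost (A ℓ) (G ℓ) (Q ℓ) (R ℓ) (opE μ g U ℓ) x u
      ≤ cost (A ℓ) (G ℓ) (Q ℓ) (R ℓ) (opE μ g V ℓ) x u := by
  unfold cost
  gcongr
  exact opE_mono hg hU hV h ℓ _

theorem opR_form_mono (hg : HasDensity μ 𝔾 g) (hU : MemHInf μ U) (hV : MemHInf μ V)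
    (h : ∀ᵐ t ∂μ, ∀ x, x ⬝ᵥ U t *ᵥ x ≤ x ⬝ᵥ V t *ᵥ x) (ℓ : Θ) (u : Fin m → ℝ) :
    u ⬝ᵥ opR μ g G R U ℓ *ᵥ u ≤ u ⬝ᵥ opR μ g G R V ℓ *ᵥ u := by
  have := cost_opE_mono (A := fun _ => 0) (G := G) (Q := fun _ => 0) (R := R) hg hU hV h ℓ 0 u
  rwa [cost_zero_left, cost_zero_left] at this

/-- A minimum over `u` of costs that increase with the weight is itself increasing. The minimizer
for `V` is inserted into the cost for `U`, whose square term is nonnegative by coercivity. -/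
theorem riccatiMap_mono (hg : HasDensity μ 𝔾 g) (hR : ∀ ℓ, (R ℓ).IsSymm) (hU : MemSHInf μ U)
    (hV : MemSHInf μ V) (h : ∀ᵐ t ∂μ, ∀ x, x ⬝ᵥ U t *ᵥ x ≤ x ⬝ᵥ V t *ᵥ x) {ξ : ℝ} (hξ : 0 < ξ)
    (hW : ∀ᵐ ℓ ∂μ, ∀ u, ξ * (u ⬝ᵥ u) ≤ u ⬝ᵥ opR μ g G R U ℓ *ᵥ u) :
    ∀ᵐ ℓ ∂μ, ∀ x, x ⬝ᵥ riccatiMap μ g A G Q R U ℓ *ᵥ x ≤ x ⬝ᵥ riccatiMap μ g A G Q R V ℓ *ᵥ x := by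
  filter_upwards [hW] with ℓ hW x
  have hWV : ∀ u, ξ * (u ⬝ᵥ u) ≤ u ⬝ᵥ opR μ g G R V ℓ *ᵥ u := fun u =>
    (hW u).trans (opR_form_mono hg hU.toMemHInf hV.toMemHInf h ℓ u)
  rw [← cost_opM hR hV.symm (isUnit_of_pos hξ hWV)]
  refine le_trans ?_ (cost_opE_mono hg hU.toMemHInf hV.toMemHInf h ℓ _ _)
  rw [cost_opE_eq_add_square hR hU.symm (isUnit_of_pos hξ hW)]
  exact le_add_of_nonneg_right ((mul_nonneg hξ.le (dotProduct_self_nonneg' _)).trans (hW _))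

/-- The block matrix inequality makes `P` a strict subsolution of the Riccati equation in the sense
of quadratic forms. -/
theorem cost_of_blockLMI {ξ : ℝ} (hP : MemSHInf μ P)
    (h : ∀ᵐ ℓ ∂μ, (blockLMI μ g A G Q R P ℓ
      - ξ • (1 : Matrix (Fin n ⊕ Fin m) (Fin n ⊕ Fin m) ℝ)).PosSemidef) :
    ∀ᵐ ℓ ∂μ, ∀ x u, x ⬝ᵥ P ℓ *ᵥ x + ξ * (x ⬝ᵥ x + u ⬝ᵥ u)
      ≤ cost (A ℓ) (G ℓ) (Q ℓ) (R ℓ) (opE μ g P ℓ) x u := by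
  filter_upwards [h] with ℓ h x u
  have h1 := le_dotProduct_mulVec_of_posSemidef h (Sum.elim x u)
  rw [blockLMI, Matrix.fromBlocks_mulVec, sumElim_dotProduct_sumElim,
    sumElim_dotProduct_sumElim] at h1
  simp only [Sum.elim_comp_inl, Sum.elim_comp_inr, dotProduct_add, Matrix.add_mulVec,
    Matrix.neg_mulVec, dotProduct_neg] at h1
  have h2 : x ⬝ᵥ (opG μ g A G P ℓ)ᵀ *ᵥ u = u ⬝ᵥ opG μ g A G P ℓ *ᵥ x := by
    rw [Matrix.mulVec_transpose, ← dotProduct_comm, Matrix.dotProduct_mulVec]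
  rw [h2] at h1
  rw [cost_eq_expand (opE_isSymm hP.symm ℓ)]
  simp only [Matrix.add_mulVec, dotProduct_add]
  simp only [opR, opT, opG, Matrix.add_mulVec, dotProduct_add] at h1
  linarith

theorem opR_coercive_of_strict_subsolution {L : Θ → Matrix (Fin n) (Fin n) ℝ} {ξ : ℝ}
    (hsub : ∀ᵐ ℓ ∂μ, ∀ x u, x ⬝ᵥ L ℓ *ᵥ x + ξ * (x ⬝ᵥ x + u ⬝ᵥ u)
      ≤ cost (A ℓ) (G ℓ) (Q ℓ) (R ℓ) (opE μ g L ℓ) x u) :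
    ∀ᵐ ℓ ∂μ, ∀ u, ξ * (u ⬝ᵥ u) ≤ u ⬝ᵥ opR μ g G R L ℓ *ᵥ u := by
  filter_upwards [hsub] with ℓ h u
  have := h 0 u
  rw [cost_zero_left] at this
  simpa [opR, opT] using this

/-- The subsolution inequality holds for every control, in particular for the minimizer belonging to
`P`. -/
theorem le_riccatiMap_of_le (hg : HasDensity μ 𝔾 g) (hR : ∀ ℓ, (R ℓ).IsSymm)
    {L : Θ → Matrix (Fin n) (Fin n) ℝ} (hL : MemHInf μ L) {ξ : ℝ} (hξ : 0 < ξ)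
    (hsub : ∀ᵐ ℓ ∂μ, ∀ x u, x ⬝ᵥ L ℓ *ᵥ x + ξ * (x ⬝ᵥ x + u ⬝ᵥ u)
      ≤ cost (A ℓ) (G ℓ) (Q ℓ) (R ℓ) (opE μ g L ℓ) x u)
    (hP : MemSHInf μ P) (hLP : ∀ᵐ ℓ ∂μ, ∀ x, x ⬝ᵥ L ℓ *ᵥ x ≤ x ⬝ᵥ P ℓ *ᵥ x)
    (hW : ∀ᵐ ℓ ∂μ, ∀ u, ξ * (u ⬝ᵥ u) ≤ u ⬝ᵥ opR μ g G R P ℓ *ᵥ u) :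
    ∀ᵐ ℓ ∂μ, ∀ x, x ⬝ᵥ L ℓ *ᵥ x ≤ x ⬝ᵥ riccatiMap μ g A G Q R P ℓ *ᵥ x := by
  filter_upwards [hsub, hW] with ℓ h1 h2 x
  rw [← cost_opM hR hP.symm (isUnit_of_pos hξ h2)]
  refine le_trans ?_ (cost_opE_mono hg hL hP.toMemHInf hLP ℓ _ _)
  refine le_trans ?_ (h1 x _)
  exact le_add_of_nonneg_right (mul_nonneg hξ.le
    (add_nonneg (dotProduct_self_nonneg' _) (dotProduct_self_nonneg' _)))

theorem riccatiMap_zero (ℓ : Θ) : riccatiMap μ g A G Q R (fun _ => 0) ℓ = Q ℓ := by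
  have h0 : opE μ g (fun _ => (0 : Matrix (Fin n) (Fin n) ℝ)) ℓ = 0 := by
    ext i j
    simp [opE]
  simp [riccatiMap, opT, opG, h0]

/-! ### Passing to the limit in the Riccati map -/

theorem continuous_riccati_expr {n m : ℕ} (A Q : Matrix (Fin n) (Fin n) ℝ)
    (G : Matrix (Fin n) (Fin m) ℝ) :
    Continuous fun p : Matrix (Fin n) (Fin n) ℝ × Matrix (Fin m) (Fin m) ℝ =>
      Aᵀ * p.1 * A + Q - (Gᵀ * p.1 * A)ᵀ * p.2 * (Gᵀ * p.1 * A) := by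
  have h1 : Continuous fun p : Matrix (Fin n) (Fin n) ℝ × Matrix (Fin m) (Fin m) ℝ =>
      Gᵀ * p.1 * A := (continuous_const.matrix_mul continuous_fst).matrix_mul continuous_const
  have h2 : Continuous fun p : Matrix (Fin n) (Fin n) ℝ × Matrix (Fin m) (Fin m) ℝ =>
      Aᵀ * p.1 * A := (continuous_const.matrix_mul continuous_fst).matrix_mul continuous_const
  exact (h2.add continuous_const).sub
    ((h1.matrix_transpose.matrix_mul continuous_snd).matrix_mul h1)

theorem tendsto_riccatiMap {S : ℕ → Θ → Matrix (Fin n) (Fin n) ℝ} {ℓ : Θ}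
    (hE : Tendsto (fun k => opE μ g (S k) ℓ) atTop (nhds (opE μ g P ℓ)))
    (hW : IsUnit (opR μ g G R P ℓ)) :
    Tendsto (fun k => riccatiMap μ g A G Q R (S k) ℓ) atTop
      (nhds (riccatiMap μ g A G Q R P ℓ)) := by
  have hcont : Continuous fun E : Matrix (Fin n) (Fin n) ℝ => R ℓ + (G ℓ)ᵀ * E * G ℓ :=
    continuous_const.add ((continuous_const.matrix_mul continuous_id).matrix_mul continuous_const)
  have hWlim : Tendsto (fun k => opR μ g G R (S k) ℓ) atTop (nhds (opR μ g G R P ℓ)) :=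
    (hcont.tendsto (opE μ g P ℓ)).comp hE
  have hI : Tendsto (fun k => (opR μ g G R (S k) ℓ)⁻¹) atTop (nhds (opR μ g G R P ℓ)⁻¹) :=
    Tendsto.comp (g := fun M : Matrix (Fin m) (Fin m) ℝ => M⁻¹)
      (continuousAt_inv_of_isUnit hW).tendsto hWlim
  have hp : Tendsto (fun k => (opE μ g (S k) ℓ, (opR μ g G R (S k) ℓ)⁻¹)) atTop
      (nhds (opE μ g P ℓ, (opR μ g G R P ℓ)⁻¹)) := hE.prodMk_nhds hI
  have := ((continuous_riccati_expr (A ℓ) (Q ℓ) (G ℓ)).tendsto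
    (opE μ g P ℓ, (opR μ g G R P ℓ)⁻¹)).comp hp
  simpa only [riccatiMap, opT, opG, Function.comp_def] using this

/-- The Riccati equation has a solution above any strict subsolution that is negative
semidefinite. -/
theorem exists_riccati_solution_ge (hg : HasDensity μ 𝔾 g) (hA : MemHInf μ A) (hG : MemHInf μ G)
    (hQ : MemHInfNonpos μ Q) (hR : MemSHInf μ R) {L : Θ → Matrix (Fin n) (Fin n) ℝ}
    (hL : MemSHInf μ L) (hL0 : ∀ᵐ ℓ ∂μ, ∀ x, x ⬝ᵥ L ℓ *ᵥ x ≤ 0) {ξ : ℝ} (hξ : 0 < ξ)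
    (hsub : ∀ᵐ ℓ ∂μ, ∀ x u, x ⬝ᵥ L ℓ *ᵥ x + ξ * (x ⬝ᵥ x + u ⬝ᵥ u)
      ≤ cost (A ℓ) (G ℓ) (Q ℓ) (R ℓ) (opE μ g L ℓ) x u) :
    ∃ P : Θ → Matrix (Fin n) (Fin n) ℝ, IsRiccatiSolution μ g A G Q R P ∧
      (∀ᵐ ℓ ∂μ, ∀ x, x ⬝ᵥ L ℓ *ᵥ x ≤ x ⬝ᵥ P ℓ *ᵥ x) ∧
      ∀ᵐ ℓ ∂μ, ∀ u, ξ * (u ⬝ᵥ u) ≤ u ⬝ᵥ opR μ g G R P ℓ *ᵥ u := by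
  -- The same `ξ` works for everything above `L`, so coercivity is uniform along the iteration and
  -- survives in the limit.
  have hW : ∀ V : Θ → Matrix (Fin n) (Fin n) ℝ, MemSHInf μ V →
      (∀ᵐ ℓ ∂μ, ∀ x, x ⬝ᵥ L ℓ *ᵥ x ≤ x ⬝ᵥ V ℓ *ᵥ x) →
      ∀ᵐ ℓ ∂μ, ∀ u, ξ * (u ⬝ᵥ u) ≤ u ⬝ᵥ opR μ g G R V ℓ *ᵥ u := fun V hV h =>
    (opR_coercive_of_strict_subsolution hsub).mono fun ℓ h1 u =>
      (h1 u).trans (opR_form_mono hg hL.toMemHInf hV.toMemHInf h ℓ u)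
  obtain ⟨S, hS0, hSsucc⟩ : ∃ S : ℕ → Θ → Matrix (Fin n) (Fin n) ℝ, S 0 = (fun _ => 0) ∧
      ∀ k, S (k + 1) = riccatiMap μ g A G Q R (S k) :=
    ⟨fun k => (riccatiMap μ g A G Q R)^[k] fun _ => 0, rfl,
      fun k => Function.iterate_succ_apply' _ _ _⟩
  have hS : ∀ k, MemSHInf μ (S k) ∧ ∀ᵐ ℓ ∂μ, ∀ x, x ⬝ᵥ L ℓ *ᵥ x ≤ x ⬝ᵥ S k ℓ *ᵥ x := by
    intro k
    induction k with
    | zero =>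
      rw [hS0]
      refine ⟨⟨.of_entries (c := 0) (fun i j => measurable_const) (by simp),
        fun ℓ => Matrix.isSymm_zero⟩, ?_⟩
      simpa using hL0
    | succ k ih =>
      rw [hSsucc]
      exact ⟨MemSHInf.riccatiMap hg hA hG hQ.1 hR ih.1 hξ (hW _ ih.1 ih.2),
        le_riccatiMap_of_le hg hR.symm hL.toMemHInf hξ hsub ih.1 ih.2 (hW _ ih.1 ih.2)⟩
  have hanti : ∀ k, ∀ᵐ ℓ ∂μ, ∀ x, x ⬝ᵥ S (k + 1) ℓ *ᵥ x ≤ x ⬝ᵥ S k ℓ *ᵥ x := by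
    intro k
    induction k with
    | zero =>
      filter_upwards [hQ.2] with ℓ h x
      have h1 := h.dotProduct_mulVec_nonneg x
      rw [star_trivial, Matrix.neg_mulVec, dotProduct_neg] at h1
      rw [hSsucc, hS0, riccatiMap_zero, Matrix.zero_mulVec, dotProduct_zero]
      linarith
    | succ k ih =>
      have := riccatiMap_mono (A := A) (Q := Q) hg hR.symm (hS (k + 1)).1 (hS k).1 ih hξ
        (hW _ (hS (k + 1)).1 (hS (k + 1)).2)
      rwa [← hSsucc, ← hSsucc] at this
  obtain ⟨P, hP, hlim, c, hc⟩ := MemSHInf.exists_antitone_limit (fun k => (hS k).1)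
    hL.toMemHInf hanti fun k => (hS k).2
  have hLP : ∀ᵐ ℓ ∂μ, ∀ x, x ⬝ᵥ L ℓ *ᵥ x ≤ x ⬝ᵥ P ℓ *ᵥ x := by
    filter_upwards [hlim, ae_all_iff.2 fun k => (hS k).2] with ℓ h1 h2 x
    exact ge_of_tendsto (((continuous_dotProduct_mulVec x x).tendsto _).comp h1)
      (Eventually.of_forall fun k => h2 k x)
  have hWP := hW P hP hLP
  refine ⟨P, ⟨hP, hWP.mono fun ℓ h => isUnit_of_pos hξ h, ?_⟩, hLP, hWP⟩
  filter_upwards [hlim, hWP] with ℓ h1 h2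
  have h3 : Tendsto (fun k => S (k + 1) ℓ) atTop (nhds (P ℓ)) :=
    (tendsto_add_atTop_iff_nat 1).2 h1
  simp only [hSsucc] at h3
  exact tendsto_nhds_unique h3 (tendsto_riccatiMap
    (tendsto_opE hg (fun k => (hS k).1.toMemHInf) hc hlim ℓ) (isUnit_of_pos hξ h2))

end Riccati

end MJLS

namespace MJLS

/-! ### The transition operator of the joint process `(ϑ(k), x(k))` -/

theorem state_congr {Θ : Type*} {n : ℕ} {A : Θ → Matrix (Fin n) (Fin n) ℝ}
    (x₀ : EuclideanSpace ℝ (Fin n)) {ω ω' : ℕ → Θ} {k : ℕ} (h : ∀ i < k, ω i = ω' i) : state A x₀ ω k = state A x₀ ω' k := by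
  induction k with
  | zero => rfl
  | succ k ih =>
    simp only [state]
    rw [ih fun i hi => h i (hi.trans k.lt_succ_self), h k k.lt_succ_self]

section Chain

variable {Θ : Type*} [MeasurableSpace Θ] {n : ℕ}

/-- The transition operator of the joint process `(ϑ(k), x(k))` acting on nonnegative
functions. -/
noncomputable def jointOp (𝔾 : Kernel Θ Θ) (A : Θ → Matrix (Fin n) (Fin n) ℝ)
    (h : Θ → (Fin n → ℝ) → ℝ≥0∞) : Θ → (Fin n → ℝ) → ℝ≥0∞ :=
  fun ℓ x => ∫⁻ t, h t (A ℓ *ᵥ x) ∂𝔾 ℓ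

/-- The squared Euclidean norm of the state, as a function of the joint process. -/
noncomputable def sqNorm (Θ : Type*) (n : ℕ) : Θ → (Fin n → ℝ) → ℝ≥0∞ :=
  fun _ x => ENNReal.ofReal (x ⬝ᵥ x)

theorem jointOp_le_mul {μ : Measure Θ} {𝔾 : Kernel Θ Θ} {g : Θ → Θ → ℝ≥0}
    {A : Θ → Matrix (Fin n) (Fin n) ℝ} (hg : HasDensity μ 𝔾 g) {h h' : Θ → (Fin n → ℝ) → ℝ≥0∞} {c : ℝ≥0∞}
    (hc : c ≠ ∞) (hle : ∀ᵐ t ∂μ, ∀ x, h t x ≤ c * h' t x) (ℓ : Θ) (x : Fin n → ℝ) :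
    jointOp 𝔾 A h ℓ x ≤ c * jointOp 𝔾 A h' ℓ x := by
  -- Finiteness of `c` replaces measurability of `h'` here.
  rw [jointOp, jointOp, ← lintegral_const_mul' _ _ hc]
  exact lintegral_mono_ae ((hg.ae hle ℓ).mono fun t ht => ht _)

theorem jointOp_iterate_le_mul {μ : Measure Θ} {𝔾 : Kernel Θ Θ} {g : Θ → Θ → ℝ≥0}
    {A : Θ → Matrix (Fin n) (Fin n) ℝ} (hg : HasDensity μ 𝔾 g) {h h' : Θ → (Fin n → ℝ) → ℝ≥0∞}
    {c : ℝ≥0∞} (hc : c ≠ ∞) (hle : ∀ᵐ t ∂μ, ∀ x, h t x ≤ c * h' t x) (k : ℕ) :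
    ∀ᵐ ℓ ∂μ, ∀ x, (jointOp 𝔾 A)^[k] h ℓ x ≤ c * (jointOp 𝔾 A)^[k] h' ℓ x := by
  induction k with
  | zero => exact hle
  | succ k ih =>
    rw [Function.iterate_succ_apply', Function.iterate_succ_apply']
    exact Eventually.of_forall fun ℓ x => jointOp_le_mul hg hc ih ℓ x

theorem jointOp_iterate_le_pow_mul {μ : Measure Θ} {𝔾 : Kernel Θ Θ} {g : Θ → Θ → ℝ≥0}
    {A : Θ → Matrix (Fin n) (Fin n) ℝ} (hg : HasDensity μ 𝔾 g) {h : Θ → (Fin n → ℝ) → ℝ≥0∞}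
    {c : ℝ≥0∞} (hc : c ≠ ∞) (hle : ∀ᵐ t ∂μ, ∀ x, jointOp 𝔾 A h t x ≤ c * h t x) (k : ℕ) :
    ∀ᵐ ℓ ∂μ, ∀ x, (jointOp 𝔾 A)^[k] h ℓ x ≤ c ^ k * h ℓ x := by
  induction k with
  | zero => simp
  | succ k ih =>
    rw [Function.iterate_succ_apply']
    filter_upwards [hle] with ℓ h1 x
    refine (jointOp_le_mul hg (ENNReal.pow_ne_top hc) ih ℓ x).trans ?_
    rw [pow_succ, mul_assoc]
    gcongr
    exact h1 x

variable {μ : Measure Θ} {𝔾 : Kernel Θ Θ} [IsMarkovKernel 𝔾]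
  {A : Θ → Matrix (Fin n) (Fin n) ℝ}

theorem measurable_mulVec_uncurry {α : Type*} [MeasurableSpace α]
    {B : α → Matrix (Fin n) (Fin n) ℝ} {y : α → Fin n → ℝ}
    (hB : ∀ i j, Measurable fun a => B a i j) (hy : Measurable y) :
    Measurable fun a => B a *ᵥ y a := by
  refine measurable_pi_lambda _ fun i => ?_
  simp only [Matrix.mulVec, dotProduct]
  exact Finset.measurable_sum _ fun j _ => (hB i j).mul ((measurable_pi_apply j).comp hy)

theorem measurable_sqNorm : Measurable (Function.uncurry (sqNorm Θ n)) := by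
  refine ENNReal.measurable_ofReal.comp ?_
  simp only [dotProduct]
  exact Finset.measurable_sum _ fun j _ =>
    ((measurable_pi_apply j).comp measurable_snd).mul ((measurable_pi_apply j).comp measurable_snd)

theorem measurable_jointOp (hA : ∀ i j, Measurable fun ℓ => A ℓ i j)
    {h : Θ → (Fin n → ℝ) → ℝ≥0∞} (hh : Measurable (Function.uncurry h)) :
    Measurable (Function.uncurry (jointOp 𝔾 A h)) := by
  have h1 : Measurable fun q : (Θ × (Fin n → ℝ)) × Θ => h q.2 (A q.1.1 *ᵥ q.1.2) :=
    hh.comp (measurable_snd.prodMk (measurable_mulVec_uncurry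
      (fun i j => (hA i j).comp (measurable_fst.comp measurable_fst))
      (measurable_snd.comp measurable_fst)))
  exact h1.lintegral_kernel_prod_right' (κ := 𝔾.comap Prod.fst measurable_fst)

theorem measurable_jointOp_iterate (hA : ∀ i j, Measurable fun ℓ => A ℓ i j)
    {h : Θ → (Fin n → ℝ) → ℝ≥0∞} (hh : Measurable (Function.uncurry h)) (k : ℕ) :
    Measurable (Function.uncurry ((jointOp 𝔾 A)^[k] h)) := by
  induction k with
  | zero => exact hh
  | succ k ih =>
    rw [Function.iterate_succ_apply']
    exact measurable_jointOp hA ih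

theorem measurable_state {α : Type*} [MeasurableSpace α] (hA : ∀ i j, Measurable fun ℓ => A ℓ i j)
    (x₀ : EuclideanSpace ℝ (Fin n)) {ω : α → ℕ → Θ} (hω : Measurable ω) (k : ℕ) :
    Measurable fun a => (state A x₀ (ω a) k).ofLp := by
  induction k with
  | zero => exact measurable_const (a := x₀.ofLp)
  | succ k ih =>
    exact measurable_mulVec_uncurry
      (fun i j => (hA i j).comp ((measurable_pi_apply k).comp hω)) ih

/-! ### Markov property of the chain law -/

theorem map_eval_zero_chainLaw (μ₀ : Measure Θ) [IsProbabilityMeasure μ₀] :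
    (chainLaw μ₀ 𝔾).map (fun ω => ω 0) = μ₀ := by
  have h1 : (chainLaw μ₀ 𝔾).map (Preorder.frestrictLe 0)
      = μ₀.map (MeasurableEquiv.piUnique fun _ : Finset.Iic 0 => Θ).symm := by
    rw [chainLaw, Kernel.trajMeasure, Measure.map_comp _ _ (by fun_prop),
      Kernel.traj_map_frestrictLe, Kernel.partialTraj_self, Measure.id_comp]
  have h2 : (fun ω : ℕ → Θ => ω 0)
      = (fun q : Finset.Iic 0 → Θ => q ⟨0, Finset.mem_Iic.2 le_rfl⟩) ∘ Preorder.frestrictLe 0 := rfl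
  rw [h2, ← Measure.map_map (by fun_prop) (by fun_prop), h1, Measure.map_map (by fun_prop)
    (by fun_prop)]
  exact Measure.map_id

/-- The state at time `k + 1` is a function of `ϑ(0), …, ϑ(k)` only, so conditioning on that history
integrates `ϑ(k+1)` alone, against `𝔾 (ϑ(k))`. -/
theorem lintegral_chainLaw_succ (hA : ∀ i j, Measurable fun ℓ => A ℓ i j) (μ₀ : Measure Θ)
    [IsProbabilityMeasure μ₀] (x₀ : EuclideanSpace ℝ (Fin n)) {h : Θ → (Fin n → ℝ) → ℝ≥0∞}
    (hh : Measurable (Function.uncurry h)) (k : ℕ) :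
    ∫⁻ ω, h (ω (k + 1)) (state A x₀ ω (k + 1)).ofLp ∂chainLaw μ₀ 𝔾
      = ∫⁻ ω, jointOp 𝔾 A h (ω k) (state A x₀ ω k).ofLp ∂chainLaw μ₀ 𝔾 := by
  -- A finite history is prolonged by repeating its last point; `state` at time `k + 1` never reads
  -- the added coordinates.
  set ext : (Finset.Iic k → Θ) → ℕ → Θ := fun q i =>
    if hi : i ≤ k then q ⟨i, Finset.mem_Iic.2 hi⟩ else q ⟨k, Finset.mem_Iic.2 le_rfl⟩ with hext
  have hextm : Measurable ext := by
    refine measurable_pi_lambda _ fun i => ?_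
    by_cases hi : i ≤ k <;> simp only [hext, hi, dite_true, dite_false] <;>
      exact measurable_pi_apply _
  set F : (Finset.Iic k → Θ) × Θ → ℝ≥0∞ := fun p =>
    h p.2 (state A x₀ (ext p.1) (k + 1)).ofLp with hF
  have hFm : Measurable F := hh.comp (measurable_snd.prodMk
    (measurable_state hA x₀ (hextm.comp measurable_fst) (k + 1)))
  have hs : ∀ ω : ℕ → Θ, state A x₀ (ext (Preorder.frestrictLe k ω)) (k + 1)
      = state A x₀ ω (k + 1) := fun ω => state_congr x₀ fun i hi => by
    simp [hext, Nat.lt_succ_iff.1 hi]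
  have hmap := Kernel.map_frestrictLe_trajMeasure_compProd_eq_map_trajMeasure
    (X := fun _ => Θ) (μ₀ := μ₀) (κ := stepKernel 𝔾) (a := k)
  have h1 : ∫⁻ ω, h (ω (k + 1)) (state A x₀ ω (k + 1)).ofLp ∂chainLaw μ₀ 𝔾
      = ∫⁻ p, F p ∂(chainLaw μ₀ 𝔾).map (fun ω => (Preorder.frestrictLe k ω, ω (k + 1))) := by
    rw [lintegral_map hFm (by fun_prop)]
    simp only [hF, hs]
  rw [h1]
  change ∫⁻ p, F p ∂(Kernel.trajMeasure (X := fun _ => Θ) μ₀ (stepKernel 𝔾)).map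
    (fun ω => (Preorder.frestrictLe k ω, ω (k + 1))) = _
  rw [← hmap, Measure.lintegral_compProd hFm, lintegral_map hFm.lintegral_kernel_prod_right'
    (by fun_prop)]
  refine lintegral_congr fun ω => ?_
  simp only [hF, hs]
  rfl

theorem lintegral_chainLaw (hA : ∀ i j, Measurable fun ℓ => A ℓ i j) (μ₀ : Measure Θ)
    [IsProbabilityMeasure μ₀] (x₀ : EuclideanSpace ℝ (Fin n)) {h : Θ → (Fin n → ℝ) → ℝ≥0∞}
    (hh : Measurable (Function.uncurry h)) (k : ℕ) :
    ∫⁻ ω, h (ω k) (state A x₀ ω k).ofLp ∂chainLaw μ₀ 𝔾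
      = ∫⁻ ℓ, (jointOp 𝔾 A)^[k] h ℓ x₀.ofLp ∂μ₀ := by
  induction k generalizing h with
  | zero =>
    conv_rhs => rw [← map_eval_zero_chainLaw (𝔾 := 𝔾) μ₀]
    have hm : Measurable fun ℓ => h ℓ x₀.ofLp :=
      hh.comp (measurable_id.prodMk measurable_const)
    exact (lintegral_map hm (measurable_pi_apply 0)).symm
  | succ k ih =>
    rw [lintegral_chainLaw_succ hA μ₀ x₀ hh, ih (measurable_jointOp hA hh),
      Function.iterate_succ_apply]

theorem enorm_sq_eq_ofReal_dotProduct (x : EuclideanSpace ℝ (Fin n)) :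
    ‖x‖ₑ ^ 2 = ENNReal.ofReal (x.ofLp ⬝ᵥ x.ofLp) := by
  rw [← ofReal_norm, ← ENNReal.ofReal_pow (norm_nonneg _), EuclideanSpace.real_norm_sq_eq]
  simp only [dotProduct, sq]

theorem lintegral_enorm_state_sq (hA : ∀ i j, Measurable fun ℓ => A ℓ i j) (μ₀ : Measure Θ)
    [IsProbabilityMeasure μ₀] (x₀ : EuclideanSpace ℝ (Fin n)) (k : ℕ) :
    ∫⁻ ω, ‖state A x₀ ω k‖ₑ ^ 2 ∂chainLaw μ₀ 𝔾
      = ∫⁻ ℓ, (jointOp 𝔾 A)^[k] (sqNorm Θ n) ℓ x₀.ofLp ∂μ₀ := by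
  rw [← lintegral_chainLaw hA μ₀ x₀ measurable_sqNorm]
  simp only [enorm_sq_eq_ofReal_dotProduct, sqNorm]

/-! ### Lyapunov characterization of exponential mean-square stability -/

variable {g : Θ → Θ → ℝ≥0}

theorem jointOp_ofReal_form (hg : HasDensity μ 𝔾 g) {V : Θ → Matrix (Fin n) (Fin n) ℝ}
    (hV : MemHInf μ V) (hpos : ∀ᵐ t ∂μ, ∀ x, 0 ≤ x ⬝ᵥ V t *ᵥ x) (ℓ : Θ) (x : Fin n → ℝ) :
    jointOp 𝔾 A (fun t y => ENNReal.ofReal (y ⬝ᵥ V t *ᵥ y)) ℓ x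
      = ENNReal.ofReal ((A ℓ *ᵥ x) ⬝ᵥ opE μ g V ℓ *ᵥ (A ℓ *ᵥ x)) := by
  rw [dotProduct_opE_mulVec hg hV, jointOp,
    ofReal_integral_eq_lintegral_ofReal (hV.integrable_form hg ℓ _ _)
      ((hg.ae hpos ℓ).mono fun t ht => ht _)]

/-- With `v(ℓ, x) = xᵀ V(ℓ) x`, one has `|x|² ≤ ξ⁻¹ v`, the transition operator contracts `v` by
`α`, and `v ≤ c|x|²`; hence `β = ξ⁻¹ c`, raised to `1` if smaller. -/
theorem EMSS.of_lyapunov (hg : HasDensity μ 𝔾 g) (hA : ∀ i j, Measurable fun ℓ => A ℓ i j)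
    {V : Θ → Matrix (Fin n) (Fin n) ℝ} (hV : MemHInf μ V) {ξ c α : ℝ} (hξ : 0 < ξ)
    (hα0 : 0 < α) (hα1 : α < 1) (hlow : ∀ᵐ ℓ ∂μ, ∀ x, ξ * (x ⬝ᵥ x) ≤ x ⬝ᵥ V ℓ *ᵥ x)
    (hup : ∀ᵐ ℓ ∂μ, ∀ x, x ⬝ᵥ V ℓ *ᵥ x ≤ c * (x ⬝ᵥ x))
    (hdec : ∀ᵐ ℓ ∂μ, ∀ x, (A ℓ *ᵥ x) ⬝ᵥ opE μ g V ℓ *ᵥ (A ℓ *ᵥ x) ≤ α * (x ⬝ᵥ V ℓ *ᵥ x)) :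
    EMSS μ 𝔾 A := by
  refine ⟨max 1 (ξ⁻¹ * c), α, le_max_left _ _, hα0, hα1, fun μ₀ _ hμ₀ x₀ k => ?_⟩
  rw [lintegral_enorm_state_sq hA]
  have hpos : ∀ᵐ t ∂μ, ∀ x, 0 ≤ x ⬝ᵥ V t *ᵥ x := hlow.mono fun t h x =>
    (mul_nonneg hξ.le (dotProduct_self_nonneg' x)).trans (h x)
  have h1 := jointOp_iterate_le_mul (A := A) hg (h := sqNorm Θ n)
    (h' := fun t y => ENNReal.ofReal (y ⬝ᵥ V t *ᵥ y)) (c := ENNReal.ofReal ξ⁻¹)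
    ENNReal.ofReal_ne_top (hlow.mono fun t h x => by
      rw [sqNorm, ← ENNReal.ofReal_mul (inv_pos.2 hξ).le]
      refine ENNReal.ofReal_le_ofReal ?_
      have := mul_le_mul_of_nonneg_left (h x) (inv_pos.2 hξ).le
      rwa [← mul_assoc, inv_mul_cancel₀ hξ.ne', one_mul] at this) k
  have h2 := jointOp_iterate_le_pow_mul (A := A) hg
    (h := fun t y => ENNReal.ofReal (y ⬝ᵥ V t *ᵥ y)) (c := ENNReal.ofReal α)
    ENNReal.ofReal_ne_top (hdec.mono fun t h x => by
      rw [jointOp_ofReal_form hg hV hpos, ← ENNReal.ofReal_mul hα0.le]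
      exact ENNReal.ofReal_le_ofReal (h x)) k
  have h3 : ∀ᵐ ℓ ∂μ, (jointOp 𝔾 A)^[k] (sqNorm Θ n) ℓ x₀.ofLp
      ≤ ENNReal.ofReal (max 1 (ξ⁻¹ * c) * α ^ k * ‖x₀‖ ^ 2) := by
    filter_upwards [h1, h2, hup] with ℓ h1 h2 h3
    refine (h1 _).trans ((mul_le_mul_right (h2 _) _).trans ?_)
    rw [← ENNReal.ofReal_pow hα0.le, ← ENNReal.ofReal_mul (by positivity),
      ← ENNReal.ofReal_mul (by positivity)]
    refine ENNReal.ofReal_le_ofReal ?_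
    have h4 : ‖x₀‖ ^ 2 = x₀.ofLp ⬝ᵥ x₀.ofLp := by
      rw [EuclideanSpace.real_norm_sq_eq]
      simp only [dotProduct, sq]
    rw [h4]
    have h5 := dotProduct_self_nonneg' x₀.ofLp
    calc ξ⁻¹ * (α ^ k * (x₀.ofLp ⬝ᵥ V ℓ *ᵥ x₀.ofLp))
        ≤ ξ⁻¹ * (α ^ k * (c * (x₀.ofLp ⬝ᵥ x₀.ofLp))) := by gcongr; exact h3 _
      _ = (ξ⁻¹ * c) * (α ^ k * (x₀.ofLp ⬝ᵥ x₀.ofLp)) := by ring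
      _ ≤ max 1 (ξ⁻¹ * c) * (α ^ k * (x₀.ofLp ⬝ᵥ x₀.ofLp)) := by
          gcongr
          exact le_max_right _ _
      _ = _ := by ring
  refine (lintegral_mono_ae (hμ₀.ae_le h3)).trans ?_
  simp

/-- Starting the chain from `μ` conditioned on sets of finite positive measure turns the averaged
bound into a pointwise one. The null set depends on `x` and `k`. -/
theorem EMSS.exists_ae_le [SigmaFinite μ] (hA : ∀ i j, Measurable fun ℓ => A ℓ i j)
    (h : EMSS μ 𝔾 A) : ∃ β α : ℝ, 0 < α ∧ α < 1 ∧ ∀ (x : Fin n → ℝ) (k : ℕ), ∀ᵐ ℓ ∂μ,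
      (jointOp 𝔾 A)^[k] (sqNorm Θ n) ℓ x ≤ ENNReal.ofReal (β * α ^ k * (x ⬝ᵥ x)) := by
  obtain ⟨β, α, -, hα0, hα1, h⟩ := h
  refine ⟨β, α, hα0, hα1, fun x k => ?_⟩
  have hm : Measurable fun ℓ => (jointOp 𝔾 A)^[k] (sqNorm Θ n) ℓ x :=
    (measurable_jointOp_iterate hA measurable_sqNorm k).comp
      (measurable_id.prodMk measurable_const)
  refine ae_le_of_forall_setLIntegral_le_of_sigmaFinite hm fun s hs hμs => ?_
  by_cases h0 : μ s = 0
  · simp [Measure.restrict_eq_zero.2 h0]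
  have hprob : IsProbabilityMeasure (cond μ s) := cond_isProbabilityMeasure_of_finite h0 hμs.ne
  have h1 := h (cond μ s) hprob (cond_absolutelyContinuous) (WithLp.toLp 2 x) k
  rw [lintegral_enorm_state_sq hA, ProbabilityTheory.cond, lintegral_smul_measure, EuclideanSpace.real_norm_sq_eq,
    smul_eq_mul, ENNReal.inv_mul_le_iff h0 hμs.ne] at h1
  rw [lintegral_const, Measure.restrict_apply_univ, mul_comm]
  simpa only [dotProduct, sq] using h1

/-- A bounded solution of `D = Bᵀ 𝓔(D) A` vanishes if `A` and `B` are both exponentially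
mean-square stable. -/
theorem eq_zero_of_coupled_stein [SigmaFinite μ] (hg : HasDensity μ 𝔾 g)
    {B : Θ → Matrix (Fin n) (Fin n) ℝ}
    (hA : ∀ i j, Measurable fun ℓ => A ℓ i j) (hB : ∀ i j, Measurable fun ℓ => B ℓ i j)
    (hAs : EMSS μ 𝔾 A) (hBs : EMSS μ 𝔾 B) {D : Θ → Matrix (Fin n) (Fin n) ℝ} (hD : MemHInf μ D)
    (heq : ∀ᵐ ℓ ∂μ, D ℓ = (B ℓ)ᵀ * opE μ g D ℓ * A ℓ) : D =ᵐ[μ] 0 := by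
  obtain ⟨c, hc0, hc⟩ := hD.exists_form_bound
  -- Unrolling the equation `k` times: each step moves `y` along `B` and `x` along `A`, under the
  -- same chain.
  have key : ∀ k, ∀ᵐ ℓ ∂μ, ∀ y x, ‖y ⬝ᵥ D ℓ *ᵥ x‖ₑ ≤ ENNReal.ofReal c *
      ((jointOp 𝔾 B)^[k] (sqNorm Θ n) ℓ y + (jointOp 𝔾 A)^[k] (sqNorm Θ n) ℓ x) := by
    intro k
    induction k with
    | zero =>
      filter_upwards [hc] with ℓ h y x
      simp only [Function.iterate_zero, id, sqNorm]
      rw [← ENNReal.ofReal_add (dotProduct_self_nonneg' y) (dotProduct_self_nonneg' x),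
        ← ENNReal.ofReal_mul hc0, ← ofReal_norm]
      exact ENNReal.ofReal_le_ofReal (h y x)
    | succ k ih =>
      filter_upwards [heq] with ℓ h y x
      rw [h, dotProduct_transpose_mul_mulVec, dotProduct_opE_mulVec hg hD,
        Function.iterate_succ_apply', Function.iterate_succ_apply']
      refine (enorm_integral_le_lintegral_enorm _).trans ?_
      refine (lintegral_mono_ae ((hg.ae ih ℓ).mono fun t ht => ht (B ℓ *ᵥ y) (A ℓ *ᵥ x))).trans ?_
      have hm : Measurable fun t => (jointOp 𝔾 B)^[k] (sqNorm Θ n) t (B ℓ *ᵥ y) :=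
        (measurable_jointOp_iterate hB measurable_sqNorm k).comp
          (measurable_id.prodMk measurable_const)
      rw [lintegral_const_mul' _ _ ENNReal.ofReal_ne_top, lintegral_add_left hm]
      rfl
  obtain ⟨β₁, α₁, h10, h11, h1⟩ := hAs.exists_ae_le hA
  obtain ⟨β₂, α₂, h20, h21, h2⟩ := hBs.exists_ae_le hB
  have hz : ∀ i j, ∀ᵐ ℓ ∂μ, D ℓ i j = 0 := by
    intro i j
    -- Only basis vectors and countably many `k` are needed, so the null sets depending on `x` and
    -- `k` do no harm.
    filter_upwards [ae_all_iff.2 key, ae_all_iff.2 (h1 (Pi.single j 1)),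
      ae_all_iff.2 (h2 (Pi.single i 1))] with ℓ h3 h4 h5
    have hb : ∀ k : ℕ, ‖D ℓ i j‖ₑ ≤ ENNReal.ofReal c *
        (ENNReal.ofReal (β₂ * α₂ ^ k * 1) + ENNReal.ofReal (β₁ * α₁ ^ k * 1)) := by
      intro k
      have h6 := h3 k (Pi.single i 1) (Pi.single j 1)
      have h7 := h4 k
      have h8 := h5 k
      rw [single_one_dotProduct, Pi.single_eq_same] at h7 h8
      rw [Matrix.mulVec_single_one, single_one_dotProduct, Matrix.col_apply] at h6
      refine h6.trans ?_
      gcongr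
    have ht : ∀ β α : ℝ, 0 < α → α < 1 →
        Tendsto (fun k : ℕ => ENNReal.ofReal (β * α ^ k * 1)) atTop (nhds 0) := by
      intro β α h0 h1
      have := ((tendsto_pow_atTop_nhds_zero_of_lt_one h0.le h1).const_mul β).mul_const 1
      rw [mul_zero, zero_mul] at this
      simpa using ENNReal.tendsto_ofReal this
    have hlim := ENNReal.Tendsto.const_mul (a := ENNReal.ofReal c)
      ((ht β₂ α₂ h20 h21).add (ht β₁ α₁ h10 h11)) (Or.inr ENNReal.ofReal_ne_top)
    rw [add_zero, mul_zero] at hlim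
    have := ge_of_tendsto' hlim hb
    simpa using this
  filter_upwards [ae_all_iff.2 fun i => ae_all_iff.2 (hz i)] with ℓ h
  ext i j
  exact h i j

end Chain

end MJLS

namespace MJLS

/-! ### Stabilizing solutions -/

/-- For a solution `P` and `F = 𝓜(P')` the right-hand side is `P - Q - 𝓜(P')ᵀ R 𝓜(P)`. The
transposed identity with `P` and `P'` exchanged has the same last two terms, so they cancel in the
difference. -/
theorem riccati_bilinear_identity {n m : ℕ} {A Q E : Matrix (Fin n) (Fin n) ℝ}
    {G : Matrix (Fin n) (Fin m) ℝ} {R : Matrix (Fin m) (Fin m) ℝ} (hE : E.IsSymm)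
    (hW : IsUnit (R + Gᵀ * E * G)) (F : Matrix (Fin m) (Fin n) ℝ) :
    (A + G * F)ᵀ * E * (A + G * -((R + Gᵀ * E * G)⁻¹ * (Gᵀ * E * A)))
      = Aᵀ * E * A + Q - (Gᵀ * E * A)ᵀ * (R + Gᵀ * E * G)⁻¹ * (Gᵀ * E * A) - Q
        - Fᵀ * R * -((R + Gᵀ * E * G)⁻¹ * (Gᵀ * E * A)) := by
  have h1 : (R + Gᵀ * E * G) * ((R + Gᵀ * E * G)⁻¹ * (Gᵀ * E * A)) = Gᵀ * E * A :=
    Matrix.mul_nonsing_inv_cancel_left _ _ ((Matrix.isUnit_iff_isUnit_det _).1 hW)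
  have h3 : (Gᵀ * E * A)ᵀ * (R + Gᵀ * E * G)⁻¹ * (Gᵀ * E * A)
      = Aᵀ * E * G * ((R + Gᵀ * E * G)⁻¹ * (Gᵀ * E * A)) := by
    rw [Matrix.transpose_mul, Matrix.transpose_mul, Matrix.transpose_transpose, hE.eq]
    simp only [Matrix.mul_assoc]
  rw [h3]
  set X := (R + Gᵀ * E * G)⁻¹ * (Gᵀ * E * A)
  have h2 : Fᵀ * R * X = Fᵀ * (Gᵀ * E * A) - Fᵀ * (Gᵀ * E * G * X) := by
    rw [← h1]
    simp only [Matrix.add_mul, Matrix.mul_add, Matrix.mul_assoc]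
    abel
  rw [Matrix.mul_neg (Fᵀ * R), h2]
  simp only [Matrix.transpose_add, Matrix.transpose_mul, Matrix.add_mul, Matrix.mul_add,
    Matrix.mul_neg, Matrix.mul_assoc]
  abel

variable {Θ : Type*} [MeasurableSpace Θ] {n m : ℕ} {μ : Measure Θ} {𝔾 : Kernel Θ Θ}
  [IsMarkovKernel 𝔾] {g : Θ → Θ → ℝ≥0}
  {A : Θ → Matrix (Fin n) (Fin n) ℝ} {G : Θ → Matrix (Fin n) (Fin m) ℝ}
  {Q : Θ → Matrix (Fin n) (Fin n) ℝ} {R : Θ → Matrix (Fin m) (Fin m) ℝ}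

theorem IsStabilizingSolution.ae_eq [SigmaFinite μ] (hg : HasDensity μ 𝔾 g) (hA : MemHInf μ A)
    (hG : MemHInf μ G) (hQ : ∀ ℓ, (Q ℓ).IsSymm) (hR : ∀ ℓ, (R ℓ).IsSymm)
    {P P' : Θ → Matrix (Fin n) (Fin n) ℝ} (hP : IsStabilizingSolution μ 𝔾 g A G Q R P)
    (hP' : IsStabilizingSolution μ 𝔾 g A G Q R P') : P =ᵐ[μ] P' := by
  have hD := hP.mem.toMemHInf.sub hP'.mem.toMemHInf
  have h0 := eq_zero_of_coupled_stein hg (hA.add (hG.mul hP.stabilizes.1)).measurable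
    (hA.add (hG.mul hP'.stabilizes.1)).measurable hP.stabilizes.2 hP'.stabilizes.2 hD ?_
  · filter_upwards [h0] with ℓ h
    exact sub_eq_zero.1 h
  · filter_upwards [hP.invertible, hP'.invertible, hP.equation, hP'.equation] with ℓ hW hW' h h'
    have e1 := riccati_bilinear_identity (A := A ℓ) (Q := Q ℓ) (opE_isSymm hP.mem.symm ℓ) hW
      (opM μ g A G R P' ℓ)
    have e2 := riccati_bilinear_identity (A := A ℓ) (Q := Q ℓ) (opE_isSymm hP'.mem.symm ℓ) hW'
      (opM μ g A G R P ℓ)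
    change (A ℓ + G ℓ * opM μ g A G R P' ℓ)ᵀ * opE μ g P ℓ * (A ℓ + G ℓ * opM μ g A G R P ℓ)
      = riccatiMap μ g A G Q R P ℓ - Q ℓ - (opM μ g A G R P' ℓ)ᵀ * R ℓ * opM μ g A G R P ℓ at e1
    change (A ℓ + G ℓ * opM μ g A G R P ℓ)ᵀ * opE μ g P' ℓ * (A ℓ + G ℓ * opM μ g A G R P' ℓ)
      = riccatiMap μ g A G Q R P' ℓ - Q ℓ - (opM μ g A G R P ℓ)ᵀ * R ℓ * opM μ g A G R P' ℓ at e2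
    change P ℓ = riccatiMap μ g A G Q R P ℓ at h
    change P' ℓ = riccatiMap μ g A G Q R P' ℓ at h'
    rw [← h] at e1
    rw [← h'] at e2
    have e3 := congrArg Matrix.transpose e2
    simp only [Matrix.transpose_mul, Matrix.transpose_sub, Matrix.transpose_transpose,
      (opE_isSymm (μ := μ) (g := g) hP'.mem.symm ℓ).eq, (hP'.mem.symm ℓ).eq, (hQ ℓ).eq,
      (hR ℓ).eq, ← Matrix.mul_assoc] at e3
    rw [opE_sub hg hP.mem.toMemHInf hP'.mem.toMemHInf, Matrix.mul_sub, Matrix.sub_mul, e1, e3]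
    abel

theorem emss_opM_of_strict_subsolution (hg : HasDensity μ 𝔾 g) (hA : MemHInf μ A)
    (hG : MemHInf μ G) (hR : ∀ ℓ, (R ℓ).IsSymm) {P L : Θ → Matrix (Fin n) (Fin n) ℝ}
    (hP : IsRiccatiSolution μ g A G Q R P) (hM : MemHInf μ (opM μ g A G R P))
    (hL : MemHInf μ L) (hLP : ∀ᵐ ℓ ∂μ, ∀ x, x ⬝ᵥ L ℓ *ᵥ x ≤ x ⬝ᵥ P ℓ *ᵥ x) {ξ : ℝ}
    (hξ : 0 < ξ) (hsub : ∀ᵐ ℓ ∂μ, ∀ x u, x ⬝ᵥ L ℓ *ᵥ x + ξ * (x ⬝ᵥ x + u ⬝ᵥ u)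
      ≤ cost (A ℓ) (G ℓ) (Q ℓ) (R ℓ) (opE μ g L ℓ) x u) :
    EMSS μ 𝔾 fun ℓ => A ℓ + G ℓ * opM μ g A G R P ℓ := by
  have hV := hP.mem.toMemHInf.sub hL
  obtain ⟨c, hc0, hc⟩ := hV.exists_form_bound
  have hVe : ∀ ℓ y, y ⬝ᵥ opE μ g (fun t => P t - L t) ℓ *ᵥ y
      = y ⬝ᵥ opE μ g P ℓ *ᵥ y - y ⬝ᵥ opE μ g L ℓ *ᵥ y := fun ℓ y => by
    rw [opE_sub hg hP.mem.toMemHInf hL, Matrix.sub_mulVec, dotProduct_sub]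
  -- At `u = 𝓜(P) x` the cost for `P` equals `xᵀPx`, while the cost for `L` is at least `xᵀLx +
  -- ξ|x|²`; on subtraction the `Q` and `R` terms cancel.
  have hstep : ∀ᵐ ℓ ∂μ, ∀ x, ((A ℓ + G ℓ * opM μ g A G R P ℓ) *ᵥ x) ⬝ᵥ
      opE μ g (fun t => P t - L t) ℓ *ᵥ ((A ℓ + G ℓ * opM μ g A G R P ℓ) *ᵥ x)
        + ξ * (x ⬝ᵥ x) ≤ x ⬝ᵥ (P ℓ - L ℓ) *ᵥ x := by
    filter_upwards [hsub, hP.invertible, hP.equation] with ℓ h1 h2 h3 x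
    have e1 := h1 x (opM μ g A G R P ℓ *ᵥ x)
    have e2 := cost_opM (A := A) (Q := Q) hR hP.mem.symm h2 x
    change P ℓ = riccatiMap μ g A G Q R P ℓ at h3
    rw [← h3] at e2
    have e3 := mul_nonneg hξ.le (dotProduct_self_nonneg' (opM μ g A G R P ℓ *ᵥ x))
    rw [hVe, Matrix.sub_mulVec, dotProduct_sub, ← e2, Matrix.add_mulVec, ← Matrix.mulVec_mulVec]
    simp only [cost] at e1 ⊢
    linarith
  -- The form bound on the diagonal gives `2c`; adding `2ξ` keeps the constant positive when `c = 0`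
  -- and the contraction rate `1 - ξ/(2c + 2ξ)` at least `1/2`.
  have hcpos : 0 < 2 * c + 2 * ξ := by positivity
  have hα : ξ / (2 * c + 2 * ξ) < 1 := by
    rw [div_lt_one hcpos]
    linarith
  have hαpos : 0 < ξ / (2 * c + 2 * ξ) := div_pos hξ hcpos
  have hup : ∀ᵐ ℓ ∂μ, ∀ x, x ⬝ᵥ (P ℓ - L ℓ) *ᵥ x ≤ (2 * c + 2 * ξ) * (x ⬝ᵥ x) := by
    filter_upwards [hc] with ℓ h x
    have := (abs_le.1 (h x x)).2
    have := mul_nonneg hξ.le (dotProduct_self_nonneg' x)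
    linarith
  refine EMSS.of_lyapunov (α := 1 - ξ / (2 * c + 2 * ξ)) hg
    (hA.add (hG.mul hM)).measurable hV hξ (by linarith) (by linarith) ?_ hup ?_
  -- Since `𝓔(P - L) ≥ 0`, the decrease inequality itself forces `P - L ≥ ξ I`.
  · filter_upwards [hstep] with ℓ h x
    have h1 := opE_mono hg hL hP.mem.toMemHInf hLP ℓ ((A ℓ + G ℓ * opM μ g A G R P ℓ) *ᵥ x)
    have h2 := h x
    rw [hVe] at h2
    linarith
  · filter_upwards [hstep, hup] with ℓ h h' x
    have h1 := h x
    have h2 := mul_le_mul_of_nonneg_left (h' x) hαpos.le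
    rw [← mul_assoc, div_mul_cancel₀ _ hcpos.ne'] at h2
    linarith

end MJLS

theorem corollary2 {Θ : Type*} [MeasurableSpace Θ] [StandardBorelSpace Θ]
    (μ : Measure Θ) [SigmaFinite μ]
    (𝔾 : Kernel Θ Θ) [IsMarkovKernel 𝔾] (g : Θ → Θ → ℝ≥0) (hg : MJLS.HasDensity μ 𝔾 g)
    {n m : ℕ}
    (A : Θ → Matrix (Fin n) (Fin n) ℝ) (hA : MJLS.MemHInf μ A)
    (G : Θ → Matrix (Fin n) (Fin m) ℝ) (hG : MJLS.MemHInf μ G)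
    (Q : Θ → Matrix (Fin n) (Fin n) ℝ) (hQ : MJLS.MemHInfNonpos μ Q)
    (R : Θ → Matrix (Fin m) (Fin m) ℝ) (hR : MJLS.MemHInfUnifPos μ R)
    (hP : ∃ P : Θ → Matrix (Fin n) (Fin n) ℝ, MJLS.MemSHInf μ P ∧
      MJLS.UnifPos μ (fun ℓ => -P ℓ) ∧
      MJLS.UnifPos μ (MJLS.blockLMI μ g A G Q R P)) :
    ∃ P : Θ → Matrix (Fin n) (Fin n) ℝ,
      MJLS.IsStabilizingSolution μ 𝔾 g A G Q R P ∧
      MJLS.UnifPos μ (MJLS.opR μ g G R P) ∧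
      ∀ P' : Θ → Matrix (Fin n) (Fin n) ℝ,
        MJLS.IsStabilizingSolution μ 𝔾 g A G Q R P' → P' =ᵐ[μ] P := by
  obtain ⟨L, hL, ⟨η, hη, hneg⟩, ξ, hξ, hlmi⟩ := hP
  -- This places `L` below the starting point `0` of the value iteration.
  have hL0 : ∀ᵐ ℓ ∂μ, ∀ x, x ⬝ᵥ L ℓ *ᵥ x ≤ 0 := by
    filter_upwards [hneg] with ℓ h x
    have h1 := MJLS.le_dotProduct_mulVec_of_posSemidef h x
    have h2 := mul_nonneg hη.le (MJLS.dotProduct_self_nonneg' x)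
    rw [Matrix.neg_mulVec, dotProduct_neg] at h1
    linarith
  have hsub := MJLS.cost_of_blockLMI hL hlmi
  obtain ⟨P, hPs, hLP, hW⟩ :=
    MJLS.exists_riccati_solution_ge hg hA hG hQ hR.1 hL hL0 hξ hsub
  have hM := MJLS.MemHInf.opM hg hA hG hR.1.toMemHInf hPs.mem.toMemHInf hξ hW
  have hPst : MJLS.IsStabilizingSolution μ 𝔾 g A G Q R P := ⟨hPs, hM,
    MJLS.emss_opM_of_strict_subsolution hg hA hG hR.1.symm hPs hM hL.toMemHInf hLP hξ hsub⟩
  refine ⟨P, hPst, ⟨ξ, hξ, ?_⟩, fun P' hP' => hP'.ae_eq hg hA hG hQ.1.symm hR.1.symm hPst⟩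
  filter_upwards [hW] with ℓ h
  exact (MJLS.posSemidef_sub_smul_one_iff (MJLS.opR_isSymm hR.1.symm hPs.mem.symm ℓ)).2 h
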